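/- Let $n\ge 2$ be an integer, let $\mathbb{B}_n$ be the open unit ball of $\mathbb{R}^n$ and $\partial\mathbb{B}_n$ the unit sphere. For $a,x\in\mathbb{B}_n$ put $$[x,a]=\sqrt{1+|a|^2|x|^2-2\langle a,x\rangle},\qquad \varphi_a(x)=\frac{(1-|a|^2)(a-x)+|a-x|^2a}{[x,a]^2},$$ and for $\xi\in\partial\mathbb{B}_n$ let $P_\xi(x)=\dfrac{1-|x|^2}{|x-\xi|^n}$ be the Poisson kernel. Identify $x=(x_0,\dots,x_{n-1})\in\mathbb{R}^n$ with the paravector $x_0+x_1e_1+\dots+x_{n-1}e_{n-1}$ of the real Clifford algebra $\mathbb{R}_{0,n-1}$ (with $e_ie_j+e_je_i=-2\delta_{ij}$), let $\overline{x}=x_0-x_1e_1-\dots-x_{n-1}e_{n-1}$, and let $|u|=(\sum_A u_A^2)^{1/2}$ for $u=\sum_A u_Ae_A\in\mathbb{R}_{0,n-1}$, where $e_A$ is the product of the $e_h$, $h\in A\subseteq\{1,\dots,n-1\}$, in increasing order. (i) If $f$ is a positive harmonic function on $\mathbb{B}_n$, then $$\bigl|(|x|^2-1)\nabla f(x)+(n-2)\,x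 f(x)\bigr|\le n f(x),\qquad x\in\mathbb{B}_n. \tag{1}$$ (ii) If $f$ is a positive harmonic function on $\mathbb{B}_n$ and equality holds in (1) at some point $x=a\in\mathbb{B}_n$, then there is $\xi\in\partial\mathbb{B}_n$ such that $$f(x)=f(a)\,\bigl|1-\varphi_a(x)\overline{a}\bigr|^{n-2}\,P_\xi(\varphi_a(x)),\qquad x\in\mathbb{B}_n. \tag{2}$$ (iii) Conversely, for all $a\in\mathbb{B}_n$ and $\xi\in\partial\mathbb{B}_n$, every function $f:\mathbb{B}_n\to\mathbb{R}$ with $f(a)>0$ that satisfies (2) is positive and harmonic on $\mathbb{B}_n$, and equality holds in (1) for it at every $x\in\mathbb{B}_n$. -/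

import Mathlib

open scoped Gradient

noncomputable section

namespace BallHarmonic

/-! ### The real Clifford algebra with `m` imaginary units -/

/-- The quadratic form `v ↦ -(v₁² + ⋯ + vₘ²)` on `ℝᵐ`. -/
def negSq (m : ℕ) : QuadraticForm ℝ (Fin m → ℝ) :=
  QuadraticMap.weightedSumSquares ℝ (fun _ : Fin m => (-1 : ℝ))

/-- The real Clifford algebra `ℝ_{0,m}`. -/
abbrev Cl (m : ℕ) : Type := CliffordAlgebra (negSq m)

/-- The imaginary units `e_i`. -/
def imUnit {m : ℕ} (i : Fin m) : Cl m := CliffordAlgebra.ι (negSq m) (Pi.single i 1)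

/-- The basis `e_A`, `A ⊆ {1, …, m}`, of `ℝ_{0,m}`; `clBasis_apply` below identifies `e_A` with the
product of the `e_h`, `h ∈ A`, in increasing order. -/
def clBasis (m : ℕ) : Module.Basis (Finset (Fin m)) ℝ (Cl m) :=
  (Pi.basisFun ℝ (Fin m)).ExteriorAlgebra.map (CliffordAlgebra.equivExterior (negSq m)).symm

/-- The norm `|u| = (∑_A u_A²)^{1/2}` of an element `u = ∑_A u_A e_A` of `ℝ_{0,m}`. -/
def clNorm {m : ℕ} (u : Cl m) : ℝ :=
  Real.sqrt (∑ A : Finset (Fin m), ((clBasis m).repr u A) ^ 2)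

/-- The identification of `x ∈ ℝⁿ` with the paravector
`x₀ + x₁ e₁ + ⋯ + x_{n-1} e_{n-1}` of `ℝ_{0,n-1}`. -/
def para {n : ℕ} (x : EuclideanSpace ℝ (Fin n)) : Cl (n - 1) :=
  algebraMap ℝ (Cl (n - 1)) (if h : 0 < n then x ⟨0, h⟩ else 0) +
    ∑ i : Fin (n - 1), x ⟨(i : ℕ) + 1, by omega⟩ • imUnit i

/-! ### Möbius transformations and the Poisson kernel of the imUnit ball -/

/-- `[x, a] = √(1 + |a|²|x|² - 2⟨a, x⟩)`. -/
def bracket {n : ℕ} (x a : EuclideanSpace ℝ (Fin n)) : ℝ :=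
  Real.sqrt (1 + ‖a‖ ^ 2 * ‖x‖ ^ 2 - 2 * inner ℝ a x)

/-- The Möbius transformation `φ_a` of the imUnit ball. -/
def mobius {n : ℕ} (a x : EuclideanSpace ℝ (Fin n)) : EuclideanSpace ℝ (Fin n) :=
  (bracket x a ^ 2)⁻¹ • ((1 - ‖a‖ ^ 2) • (a - x) + ‖a - x‖ ^ 2 • a)

/-- The Poisson kernel `P_ξ(x) = (1 - |x|²) / |x - ξ|ⁿ`. -/
def poisson {n : ℕ} (ξ x : EuclideanSpace ℝ (Fin n)) : ℝ :=
  (1 - ‖x‖ ^ 2) / ‖x - ξ‖ ^ n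

/-- The function `x ↦ |1 - φ_a(x) ā|^{n-2} P_ξ(φ_a(x))`, with `φ_a(x)` and `a` regarded as
paravectors and `ā` the Clifford conjugate of `a`. -/
def extremal {n : ℕ} (a ξ x : EuclideanSpace ℝ (Fin n)) : ℝ :=
  clNorm (1 - para (mobius a x) * star (para a)) ^ (n - 2) * poisson ξ (mobius a x)

/-! ### Checks of the Clifford algebra definitions -/

theorem negSq_apply {m : ℕ} (v : Fin m → ℝ) : negSq m v = -∑ i, v i ^ 2 := by
  simp [negSq, QuadraticMap.weightedSumSquares_apply, pow_two]

theorem imUnit_mul_self {m : ℕ} (i : Fin m) : imUnit i * imUnit i = -1 := by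
  rw [imUnit, CliffordAlgebra.ι_sq_scalar, negSq_apply]
  simp [Pi.single_apply]

theorem imUnit_mul_imUnit {m : ℕ} {i j : Fin m} (h : i ≠ j) :
    imUnit i * imUnit j = -(imUnit j * imUnit i) := by
  rw [eq_neg_iff_add_eq_zero, imUnit, imUnit, CliffordAlgebra.ι_mul_ι_add_swap, QuadraticMap.polar,
    negSq_apply, negSq_apply, negSq_apply]
  have : ∀ k : Fin m, ((Pi.single i 1 + Pi.single j 1 : Fin m → ℝ) k) ^ 2 =
      (Pi.single i 1 : Fin m → ℝ) k ^ 2 + (Pi.single j 1 : Fin m → ℝ) k ^ 2 := by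
    intro k
    simp only [Pi.add_apply, Pi.single_apply]
    split_ifs <;> simp_all
  simp_rw [this, Finset.sum_add_distrib]
  simp

theorem contract_prod {m : ℕ} (Q : QuadraticForm ℝ (Fin m → ℝ))
    (d : Module.Dual ℝ (Fin m → ℝ)) (l : List (Fin m))
    (h : ∀ j ∈ l, d (Pi.single j 1) = 0) :
    CliffordAlgebra.contractLeft d
      (l.map fun j => CliffordAlgebra.ι Q (Pi.single j 1)).prod = 0 := by
  induction l with
  | nil => simp
  | cons j l ih =>
    rw [List.map_cons, List.prod_cons, CliffordAlgebra.contractLeft_ι_mul,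
      h j (by simp), ih fun k hk => h k (by simp [hk])]
    simp

theorem equivExterior_prod {m : ℕ} (l : List (Fin m)) (hl : l.Nodup) :
    CliffordAlgebra.equivExterior (negSq m) (l.map imUnit).prod =
      (l.map fun j => ExteriorAlgebra.ι ℝ (Pi.single j 1 : Fin m → ℝ)).prod := by
  induction l with
  | nil => simp
  | cons j l ih =>
    rw [List.nodup_cons] at hl
    have ih' := ih hl.2
    simp only [CliffordAlgebra.equivExterior, CliffordAlgebra.changeFormEquiv_apply] at ih' ⊢
    rw [List.map_cons, List.prod_cons, imUnit, CliffordAlgebra.changeForm_ι_mul, ih',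
      List.map_cons, List.prod_cons]
    have := contract_prod (0 : QuadraticForm ℝ (Fin m → ℝ))
      (QuadraticMap.associated (R := ℝ) (-negSq m) (Pi.single j 1)) l (by
        intro k hk
        have hjk : j ≠ k := fun h => hl.1 (h ▸ hk)
        have h0 : QuadraticMap.polar (negSq m) (Pi.single j 1) (Pi.single k 1) = 0 := by
          have h1 := CliffordAlgebra.ι_mul_ι_add_swap (Q := negSq m)
            (Pi.single j 1) (Pi.single k 1)
          have h2 := imUnit_mul_imUnit hjk
          rw [imUnit, imUnit] at h2
          rw [h2, neg_add_cancel] at h1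
          exact (FaithfulSMul.algebraMap_injective ℝ (Cl m)) (by rw [← h1, map_zero])
        rw [QuadraticMap.polar] at h0
        simp only [QuadraticMap.associated_apply, neg_apply]
        rw [show -negSq m (Pi.single j 1 + Pi.single k 1) - -negSq m (Pi.single j 1) -
          -negSq m (Pi.single k 1) = 0 by linarith]
        simp)
    exact (congrArg _ this).trans (sub_zero _)

/-- `e_A` is the product of the units `e_h`, `h ∈ A`, in increasing order. -/
theorem clBasis_apply {m : ℕ} (A : Finset (Fin m)) :
    clBasis m A = (A.sort.map imUnit).prod := by
  rw [clBasis, Module.Basis.map_apply, LinearEquiv.symm_apply_eq,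
    equivExterior_prod _ (A.sort_nodup _), ExteriorAlgebra.basis_apply_ofCard _ rfl,
    ExteriorAlgebra.ιMulti_family, ExteriorAlgebra.ιMulti_apply,
    ← Finset.listMap_orderEmbOfFin_finRange A rfl, List.map_map, List.ofFn_eq_map]
  simp [Set.powersetCard.ofFinEmbEquiv_symm_apply, Function.comp_def]

theorem clNorm_sum {m : ℕ} {K : Type} [Fintype K] (g : K → Finset (Fin m))
    (hg : Function.Injective g) (c : K → ℝ) :
    clNorm (∑ k, c k • clBasis m (g k)) = Real.sqrt (∑ k, c k ^ 2) := by
  classical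
  rw [clNorm]
  congr 1
  have h1 : ∀ A, (clBasis m).repr (∑ k, c k • clBasis m (g k)) A =
      ∑ k, if g k = A then c k else 0 := by
    intro A
    simp [Finsupp.single_apply]
  simp_rw [h1]
  rw [← Finset.sum_subset (Finset.subset_univ (Finset.univ.image g))]
  · rw [Finset.sum_image (fun x _ y _ h => hg h)]
    refine Finset.sum_congr rfl fun k _ => ?_
    simp [hg.eq_iff]
  · intro A _ hA
    rw [Finset.sum_eq_zero]
    · simp
    · intro k _
      rw [if_neg]
      rintro rfl
      exact hA (Finset.mem_image_of_mem _ (Finset.mem_univ k))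

theorem sum_pairs {m : ℕ} {M : Type*} [AddCommMonoid M] (F : Fin m → Fin m → M) :
    ∑ i, ∑ j, F i j = ∑ i, F i i +
      ∑ p : {p : Fin m × Fin m // p.1 < p.2}, (F p.1.1 p.1.2 + F p.1.2 p.1.1) := by
  classical
  have h1 : ∀ i j, F i j = (if i = j then F i j else 0) +
      ((if i < j then F i j else 0) + (if j < i then F i j else 0)) := by
    intro i j
    rcases lt_trichotomy i j with h | h | h
    · simp [h, h.ne, h.not_gt]
    · simp [h]
    · simp [h, h.ne', h.not_gt]
  have h2 : ∑ i, ∑ j, F i j = ∑ i, F i i + (∑ i, ∑ j, (if i < j then F i j else 0) +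
      ∑ i, ∑ j, (if j < i then F i j else 0)) := by
    rw [← Finset.sum_add_distrib, ← Finset.sum_add_distrib]
    refine Finset.sum_congr rfl fun i _ => ?_
    rw [Finset.sum_congr rfl fun j _ => h1 i j, Finset.sum_add_distrib, Finset.sum_add_distrib]
    simp
  rw [h2, Finset.sum_comm (f := fun i j => if j < i then F i j else 0),
    ← Finset.sum_add_distrib]
  congr 1
  have h3 : ∀ i, (∑ j, (if i < j then F i j else 0) + ∑ j, (if i < j then F j i else 0)) =
      ∑ j, (if i < j then F i j + F j i else 0) := by
    intro i
    rw [← Finset.sum_add_distrib]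
    refine Finset.sum_congr rfl fun j _ => ?_
    split_ifs <;> simp
  simp_rw [h3]
  rw [← Fintype.sum_prod_type' (f := fun i j => if i < j then F i j + F j i else 0),
    ← Finset.sum_filter]
  exact Finset.sum_subtype (p := fun p : Fin m × Fin m => p.1 < p.2) _ (by simp) _

/-- `[x, a] = |1 - x ā|`. -/
theorem clNorm_one_sub_para_mul_star {n : ℕ} (hn : 0 < n) (x a : EuclideanSpace ℝ (Fin n)) :
    clNorm (1 - para x * star (para a)) = bracket x a := by
  classical
  obtain ⟨m, rfl⟩ : ∃ m, n = m + 1 := ⟨n - 1, by omega⟩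
  change clNorm (m := m) _ = _
  let X : Fin m → ℝ := fun i => x i.succ
  let Y : Fin m → ℝ := fun i => a i.succ
  have hx : para x = algebraMap ℝ (Cl m) (x 0) + ∑ i, X i • imUnit i := by
    rw [para, dif_pos hn]; rfl
  have ha : star (para a) = algebraMap ℝ (Cl m) (a 0) - ∑ i, Y i • imUnit i := by
    have : para a = algebraMap ℝ (Cl m) (a 0) + ∑ i, Y i • imUnit i := by
      rw [para, dif_pos hn]; rfl
    rw [this, star_add, CliffordAlgebra.star_algebraMap, star_sum, sub_eq_add_neg,
      ← Finset.sum_neg_distrib]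
    congr 1
    refine Finset.sum_congr rfl fun i _ => ?_
    rw [CliffordAlgebra.star_smul, imUnit, CliffordAlgebra.star_ι, smul_neg]
  let g : Option (Fin m ⊕ {p : Fin m × Fin m // p.1 < p.2}) → Finset (Fin m) := fun k =>
    match k with
    | none => ∅
    | some (Sum.inl i) => {i}
    | some (Sum.inr p) => {p.1.1, p.1.2}
  let c : Option (Fin m ⊕ {p : Fin m × Fin m // p.1 < p.2}) → ℝ := fun k =>
    match k with
    | none => 1 - x 0 * a 0 - ∑ i, X i * Y i
    | some (Sum.inl i) => x 0 * Y i - a 0 * X i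
    | some (Sum.inr p) => X p.1.1 * Y p.1.2 - X p.1.2 * Y p.1.1
  have hg : Function.Injective g := by
    have hc0 : ∀ i : Fin m, ({i} : Finset (Fin m)).card = 1 := fun i => by simp
    have hc2 : ∀ p : {p : Fin m × Fin m // p.1 < p.2},
        ({p.1.1, p.1.2} : Finset (Fin m)).card = 2 := fun p => Finset.card_pair p.2.ne
    rintro (_ | i | p) (_ | j | q) h
    · rfl
    · have := congrArg Finset.card h; simp [g] at this
    · have := congrArg Finset.card h; simp [g, hc2] at this
    · have := congrArg Finset.card h; simp [g] at this
    · simpa [g] using h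
    · have := congrArg Finset.card h; simp [g, hc2] at this
    · have := congrArg Finset.card h; simp [g, hc2] at this
    · have := congrArg Finset.card h; simp [g, hc2] at this
    · obtain ⟨⟨p1, p2⟩, hp⟩ := p
      obtain ⟨⟨q1, q2⟩, hq⟩ := q
      simp only [g] at h
      have e1 : p1 ∈ ({q1, q2} : Finset (Fin m)) := h ▸ by simp
      have e2 : p2 ∈ ({q1, q2} : Finset (Fin m)) := h ▸ by simp
      simp only [Finset.mem_insert, Finset.mem_singleton] at e1 e2
      have : p1 = q1 ∧ p2 = q2 := by
        simp only at hp hq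
        constructor <;> rcases e1 with e1 | e1 <;> rcases e2 with e2 | e2 <;> subst e1 <;>
          subst e2 <;> first | rfl | (exfalso; exact lt_irrefl _ hp) |
            (exfalso; exact lt_asymm hp hq)
      simp [this]
  have hb0 : clBasis m ∅ = 1 := by simp [clBasis_apply]
  have hb1 : ∀ i, clBasis m {i} = imUnit i := fun i => by simp [clBasis_apply]
  have hb2 : ∀ p : {p : Fin m × Fin m // p.1 < p.2},
      clBasis m {p.1.1, p.1.2} = imUnit p.1.1 * imUnit p.1.2 := fun p => by
    have : (({p.1.1, p.1.2} : Finset (Fin m)).sort) = [p.1.1, p.1.2] := by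
      rw [Finset.sort_insert, Finset.sort_singleton]
      · intro b hb; rw [Finset.mem_singleton.1 hb]; exact p.2.le
      · simpa using p.2.ne
    rw [clBasis_apply, this]; simp
  have hu : 1 - para x * star (para a) = ∑ k, c k • clBasis m (g k) := by
    have hprod : (∑ i, X i • imUnit i) * (∑ i, Y i • imUnit i) =
        algebraMap ℝ (Cl m) (-∑ i, X i * Y i) +
        ∑ p : {p : Fin m × Fin m // p.1 < p.2},
          (X p.1.1 * Y p.1.2 - X p.1.2 * Y p.1.1) • (imUnit p.1.1 * imUnit p.1.2) := by
      rw [Finset.sum_mul_sum, sum_pairs]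
      congr 1
      · rw [map_neg, map_sum, ← Finset.sum_neg_distrib]
        refine Finset.sum_congr rfl fun i _ => ?_
        rw [smul_mul_smul_comm, imUnit_mul_self, Algebra.algebraMap_eq_smul_one, smul_neg]
      · refine Finset.sum_congr rfl fun p _ => ?_
        rw [smul_mul_smul_comm, smul_mul_smul_comm, imUnit_mul_imUnit p.2.ne', smul_neg, sub_smul,
          sub_eq_add_neg]
    rw [Fintype.sum_option, Fintype.sum_sum_type]
    simp only [c, g, hb0, hb1, hb2]
    rw [hx, ha, add_mul, mul_sub, mul_sub, hprod]
    simp only [sub_smul, Finset.sum_sub_distrib, mul_smul, ← Finset.smul_sum,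
      Algebra.algebraMap_eq_smul_one, neg_smul, smul_mul_assoc, mul_smul_comm, one_mul, mul_one,
      one_smul, smul_comm (a 0) (x 0)]
    module
  rw [hu, clNorm_sum g hg c, bracket]
  congr 1
  rw [Fintype.sum_option, Fintype.sum_sum_type]
  simp only [c]
  have hX : ‖x‖ ^ 2 = x 0 ^ 2 + ∑ i, X i ^ 2 := by
    rw [EuclideanSpace.real_norm_sq_eq, Fin.sum_univ_succ]
  have hY : ‖a‖ ^ 2 = a 0 ^ 2 + ∑ i, Y i ^ 2 := by
    rw [EuclideanSpace.real_norm_sq_eq, Fin.sum_univ_succ]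
  have hXY : inner ℝ a x = x 0 * a 0 + ∑ i, X i * Y i := by
    rw [PiLp.inner_apply, Fin.sum_univ_succ]
    simp [X, Y]
  have hL : ∑ p : {p : Fin m × Fin m // p.1 < p.2}, (X p.1.1 * Y p.1.2 - X p.1.2 * Y p.1.1) ^ 2 =
      (∑ i, X i ^ 2) * (∑ i, Y i ^ 2) - (∑ i, X i * Y i) ^ 2 := by
    have h1 : (∑ i, X i ^ 2) * (∑ i, Y i ^ 2) - (∑ i, X i * Y i) ^ 2 =
        ∑ i, ∑ j, (X i ^ 2 * Y j ^ 2 - X i * Y i * (X j * Y j)) := by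
      rw [pow_two (∑ i, X i * Y i), Finset.sum_mul_sum, Finset.sum_mul_sum]
      simp only [Finset.sum_sub_distrib]
    rw [h1, sum_pairs]
    have h2 : ∑ i, (X i ^ 2 * Y i ^ 2 - X i * Y i * (X i * Y i)) = 0 :=
      Finset.sum_eq_zero fun i _ => by ring
    rw [h2, zero_add]
    exact Finset.sum_congr rfl fun p _ => by ring
  have hS : ∑ i, (x 0 * Y i - a 0 * X i) ^ 2 =
      x 0 ^ 2 * ∑ i, Y i ^ 2 - 2 * (x 0 * a 0) * ∑ i, X i * Y i + a 0 ^ 2 * ∑ i, X i ^ 2 := by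
    rw [Finset.mul_sum, Finset.mul_sum, Finset.mul_sum, ← Finset.sum_sub_distrib,
      ← Finset.sum_add_distrib]
    exact Finset.sum_congr rfl fun i _ => by ring
  rw [hX, hY, hXY, hL, hS]
  ring

end BallHarmonic

end

/-! Everything rests on two facts about a boundary point ξ, namely `(|a|² - 1) ∇P_ξ(a) + (n - 2)
P_ξ(a) a = n P_ξ(a) φ_a(ξ)` (`smul_poissonGrad_add_smul`) and `|1 - φ_a(x) ā|^(n-2) P_ζ(φ_a(x)) =
P_ξ(x) / P_ξ(a)` with `ζ = φ_a(ξ)` (`extremal_mobius`). Since |φ_a(ξ)| = 1, the first says that (1)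
is an equality for every Poisson kernel. A positive harmonic function is, after a dilation, a
superposition of Poisson kernels with positive weights, so (1) is the triangle inequality for an
average of the unit vectors φ_a(ξ).

Equality forces these unit vectors to agree in the limit. For r < 1 the weights f(rξ) P_ξ(a)
represent the left side of (1) at a, up to terms that converge as r → 1. If equality holds there,
with direction v, the weighted average of |φ_a(ξ) - v|² = 2 - 2⟨φ_a(ξ), v⟩ tends to 0, so the
weights concentrate where φ_a(ξ) is near v. By the second fact, f(rx) is the average of `extremal a
(φ_a(ξ)) x` against the same weights, hence f(x) = f(a) `extremal a v x`. Working with the dilates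
and the second moment avoids a representing boundary measure for f and any weak-limit argument.

Conversely, φ_a is an involution of the sphere, so the second fact identifies each function in (2)
with a positive multiple of a Poisson kernel, and the first gives equality at every point.

The Poisson formula for the dilates is derived from the maximum principle, the rotation invariance
of surface measure and differentiation under the integral. -/

namespace BallHarmonic

/-! ### Maximum principle, integrals over the sphere, rotation invariance -/

section General

variable {E : Type*} [NormedAddCommGroup E] [InnerProductSpace ℝ E] [FiniteDimensional ℝ E]

/-- `w` is twice differentiable along the vectors of the standard orthonormal basis on the open
unit ball, and its second derivatives along these vectors sum up to zero. -/
def IsDirHarmonic (w : E → ℝ) : Prop :=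
  ∃ (w' : E → E →L[ℝ] ℝ) (w'' : Fin (Module.finrank ℝ E) → E → E →L[ℝ] ℝ),
    (∀ x ∈ Metric.ball (0 : E) 1, HasFDerivAt w (w' x) x) ∧
    (∀ i, ∀ x ∈ Metric.ball (0 : E) 1,
      HasFDerivAt (fun y => w' y (stdOrthonormalBasis ℝ E i)) (w'' i x) x) ∧
    ∀ x ∈ Metric.ball (0 : E) 1, ∑ i, w'' i x (stdOrthonormalBasis ℝ E i) = 0

theorem IsDirHarmonic.continuousOn {w : E → ℝ} (h : IsDirHarmonic w) :
    ContinuousOn w (Metric.ball 0 1) := by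
  obtain ⟨w', -, h1, -⟩ := h
  exact fun x hx => (h1 x hx).continuousAt.continuousWithinAt

theorem IsDirHarmonic.sub {u w : E → ℝ} (hu : IsDirHarmonic u) (hw : IsDirHarmonic w) :
    IsDirHarmonic (fun x => u x - w x) := by
  obtain ⟨u', u'', a1, a2, a3⟩ := hu
  obtain ⟨w', w'', b1, b2, b3⟩ := hw
  refine ⟨fun x => u' x - w' x, fun i x => u'' i x - w'' i x,
    fun x hx => (a1 x hx).sub (b1 x hx), fun i x hx => (a2 i x hx).sub (b2 i x hx), ?_⟩
  intro x hx
  simp only [sub_apply, Finset.sum_sub_distrib]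
  rw [a3 x hx, b3 x hx, sub_zero]

theorem IsDirHarmonic.const_mul {w : E → ℝ} (hw : IsDirHarmonic w) (c : ℝ) :
    IsDirHarmonic (fun x => c * w x) := by
  obtain ⟨w', w'', b1, b2, b3⟩ := hw
  refine ⟨fun x => c • w' x, fun i x => c • w'' i x,
    fun x hx => (b1 x hx).const_mul c, fun i x hx => (b2 i x hx).const_mul c, ?_⟩
  intro x hx
  simp only [smul_apply, smul_eq_mul, ← Finset.mul_sum]
  rw [b3 x hx, mul_zero]

theorem laplacian_eq_sum_fderiv {f : E → ℝ} {x : E} (hf : ContDiffAt ℝ 2 f x) :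
    Laplacian.laplacian f x =
    ∑ i, fderiv ℝ (fun y => fderiv ℝ f y (stdOrthonormalBasis ℝ E i)) x
      (stdOrthonormalBasis ℝ E i) := by
  rw [InnerProductSpace.laplacian_eq_iteratedFDeriv_stdOrthonormalBasis]
  refine Finset.sum_congr rfl fun i _ => ?_
  have hd : DifferentiableAt ℝ (fderiv ℝ f) x :=
    (hf.fderiv_right (m := 1) (by norm_num)).differentiableAt (by norm_num)
  rw [iteratedFDeriv_two_apply, fderiv_clm_apply hd (differentiableAt_const _)]
  simp

theorem isDirHarmonic_of_harmonicOnNhd {f : E → ℝ}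
    (hf : InnerProductSpace.HarmonicOnNhd f (Metric.ball 0 1)) : IsDirHarmonic f := by
  refine ⟨fderiv ℝ f, fun i x => fderiv ℝ (fun y => fderiv ℝ f y (stdOrthonormalBasis ℝ E i)) x,
    fun x hx => ((hf x hx).1.differentiableAt (by norm_num)).hasFDerivAt, ?_, ?_⟩
  · intro i x hx
    have hd : DifferentiableAt ℝ (fderiv ℝ f) x :=
      ((hf x hx).1.fderiv_right (m := 1) (by norm_num)).differentiableAt (by norm_num)
    exact (hd.clm_apply (differentiableAt_const _)).hasFDerivAt
  · intro x hx
    rw [← laplacian_eq_sum_fderiv (hf x hx).1]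
    exact (hf x hx).2.self_of_nhds

theorem IsDirHarmonic.comp_smul {f : E → ℝ} (hf : IsDirHarmonic f) {r : ℝ} (h0 : 0 ≤ r)
    (h1 : r ≤ 1) : IsDirHarmonic (fun x => f (r • x)) := by
  obtain ⟨w', w'', b1, b2, b3⟩ := hf
  have hmem : ∀ x ∈ Metric.ball (0 : E) 1, r • x ∈ Metric.ball (0 : E) 1 := by
    intro x hx
    rw [mem_ball_zero_iff] at hx ⊢
    rw [norm_smul, Real.norm_of_nonneg h0]
    nlinarith [norm_nonneg x]
  have hs : ∀ x : E, HasFDerivAt (fun y : E => r • y) (r • ContinuousLinearMap.id ℝ E) x :=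
    fun x => (hasFDerivAt_id x).const_smul r
  refine ⟨fun x => (w' (r • x)).comp (r • ContinuousLinearMap.id ℝ E),
    fun i x => r • (w'' i (r • x)).comp (r • ContinuousLinearMap.id ℝ E),
    fun x hx => (b1 _ (hmem x hx)).comp x (hs x), fun i x hx => ?_, fun x hx => ?_⟩
  · have := ((b2 i _ (hmem x hx)).comp x (hs x)).const_smul r
    refine this.congr_of_eventuallyEq (Filter.Eventually.of_forall fun y => ?_)
    simp
  · simp only [smul_apply, ContinuousLinearMap.comp_apply,
      ContinuousLinearMap.id_apply, map_smul, smul_eq_mul, ← Finset.mul_sum]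
    rw [b3 _ (hmem x hx)]
    simp

/-- If the second derivative were positive, t would also be a local minimum; then g is constant near
t and its second derivative there vanishes. -/
theorem deriv_deriv_nonpos_of_isLocalMax {g : ℝ → ℝ} {t : ℝ} (h : IsLocalMax g t)
    (hc : ContinuousAt g t) : deriv (deriv g) t ≤ 0 := by
  by_contra! hpos
  have hmin := isLocalMin_of_deriv_deriv_pos hpos h.deriv_eq_zero hc
  have hconst : g =ᶠ[nhds t] fun _ => g t := by
    filter_upwards [h, hmin] with s h1 h2 using le_antisymm h1 h2
  have h2 : deriv g =ᶠ[nhds t] fun _ => 0 := by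
    simpa using hconst.deriv
  have h3 := h2.deriv_eq
  simp at h3
  linarith

/-- The maximum principle on balls contained in the open unit ball. -/
theorem IsDirHarmonic.le_of_le_sphere [Nontrivial E] {w : E → ℝ} (hw : IsDirHarmonic w) {ρ M : ℝ}
    (hρ : ρ < 1) (hM : ∀ x : E, ‖x‖ = ρ → w x ≤ M) {x : E} (hx : ‖x‖ ≤ ρ) : w x ≤ M := by
  by_contra! hlt
  have hρ0 : 0 ≤ ρ := (norm_nonneg x).trans hx
  have hsub : Metric.closedBall (0 : E) ρ ⊆ Metric.ball 0 1 := Metric.closedBall_subset_ball hρ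
  -- Half the gap: on the sphere of radius ρ < 1 the perturbation `ε‖y‖²` adds at most ε, and M + ε
  -- < w x ≤ v x, so the maximum of v is interior.
  set ε : ℝ := (w x - M) / 2 with hε
  have hε0 : 0 < ε := by rw [hε]; linarith
  let v : E → ℝ := fun y => w y + ε * ‖y‖ ^ 2
  have hvc : ContinuousOn v (Metric.ball 0 1) :=
    hw.continuousOn.add (by fun_prop)
  obtain ⟨y, hy, hmax⟩ := (isCompact_closedBall (0 : E) ρ).exists_isMaxOn
    ⟨x, by simpa using hx⟩ (hvc.mono hsub)
  rw [mem_closedBall_zero_iff] at hy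
  have hyx : v x ≤ v y := hmax (by simpa using hx)
  have hylt : ‖y‖ < ρ := by
    refine lt_of_le_of_ne hy fun h => ?_
    have h1 := hM y h
    have h2 : ‖y‖ ^ 2 ≤ 1 := by nlinarith [norm_nonneg y]
    have h3 : w x ≤ v x := le_add_of_nonneg_right (by positivity)
    have h4 : v y ≤ M + ε := add_le_add h1 (by nlinarith)
    linarith
  have hyb : y ∈ Metric.ball (0 : E) 1 := by simpa using hylt.trans hρ
  have hloc : IsLocalMax v y := by
    filter_upwards [Metric.isOpen_ball.mem_nhds
      (show y ∈ Metric.ball (0 : E) ρ by simpa using hylt)] with z hz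
    exact hmax (Metric.ball_subset_closedBall hz)
  obtain ⟨w', w'', b1, b2, b3⟩ := hw
  -- The left side is the second derivative of v at its maximum y along the i-th basis vector.
  -- Summing over i leaves only 2ε times the dimension, which is positive.
  have key : ∀ i, w'' i y (stdOrthonormalBasis ℝ E i) + 2 * ε ≤ 0 := by
    intro i
    set e := stdOrthonormalBasis ℝ E i with he
    have hee : ‖e‖ = 1 := OrthonormalBasis.norm_eq_one _ _
    have hl : ∀ t : ℝ, HasDerivAt (fun s : ℝ => y + s • e) e t := fun t => by
      simpa using ((hasDerivAt_id t).smul_const e).const_add y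
    have hl0 : Filter.Tendsto (fun s : ℝ => y + s • e) (nhds 0) (nhds y) := by
      have := (hl 0).continuousAt.tendsto
      simpa using this
    have hgmax : IsLocalMax (fun s : ℝ => v (y + s • e)) 0 := by
      have := hl0.eventually hloc
      simpa [IsLocalMax, IsMaxFilter] using this
    have hg1 : ∀ s : ℝ, y + s • e ∈ Metric.ball (0 : E) 1 →
        HasDerivAt (fun s : ℝ => v (y + s • e))
          (w' (y + s • e) e + ε * (2 * inner ℝ (y + s • e) e)) s := by
      intro s hs
      have h1 := (hl s).norm_sq.const_mul ε
      exact ((b1 _ hs).comp_hasDerivAt s (hl s)).add h1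
    have hev : ∀ᶠ s : ℝ in nhds 0, y + s • e ∈ Metric.ball (0 : E) 1 :=
      hl0.eventually (Metric.isOpen_ball.mem_nhds hyb)
    have hd1 : deriv (fun s : ℝ => v (y + s • e)) =ᶠ[nhds 0]
        fun s => w' (y + s • e) e + ε * (2 * inner ℝ (y + s • e) e) := by
      filter_upwards [hev] with s hs using (hg1 s hs).deriv
    have hd2 : HasDerivAt (fun s : ℝ => w' (y + s • e) e + ε * (2 * inner ℝ (y + s • e) e))
        (w'' i y e + 2 * ε) 0 := by
      have h1 : HasDerivAt (fun s : ℝ => w' (y + s • e) e) (w'' i y e) 0 := by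
        have h := b2 i (y + (0 : ℝ) • e) (by simpa using hyb)
        simpa [Function.comp_def] using h.comp_hasDerivAt (0 : ℝ) (hl 0)
      have h2 : HasDerivAt (fun s : ℝ => inner ℝ (y + s • e) e) (1 : ℝ) 0 := by
        simpa [hee] using (hl 0).inner ℝ (hasDerivAt_const (0 : ℝ) e)
      exact (h1.add ((h2.const_mul 2).const_mul ε)).congr_deriv (by ring)
    have := deriv_deriv_nonpos_of_isLocalMax hgmax
      (hg1 0 (by simpa using hyb)).continuousAt
    rwa [hd1.deriv_eq, hd2.deriv] at this
  have hsum := Finset.sum_nonpos fun i (_ : i ∈ Finset.univ) => key i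
  rw [Finset.sum_add_distrib, b3 y hyb] at hsum
  have hdim : 0 < Module.finrank ℝ E := Module.finrank_pos
  simp only [Finset.sum_const, Finset.card_univ, Fintype.card_fin, nsmul_eq_mul, zero_add] at hsum
  have : (0 : ℝ) < Module.finrank ℝ E := by exact_mod_cast hdim
  nlinarith

/-- Differentiation of an integral over the unit sphere with respect to a parameter in the open
unit ball. -/
theorem hasFDerivAt_integral_sphere [MeasurableSpace E] [BorelSpace E]
    (μ : MeasureTheory.Measure (Metric.sphere (0 : E) 1)) [MeasureTheory.IsFiniteMeasure μ]
    {F : E → Metric.sphere (0 : E) 1 → ℝ} {F' : E → Metric.sphere (0 : E) 1 → E →L[ℝ] ℝ}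
    (hF : ∀ x ∈ Metric.ball (0 : E) 1, Continuous (F x))
    (hF' : ContinuousOn (fun p : E × Metric.sphere (0 : E) 1 => F' p.1 p.2)
      (Metric.ball 0 1 ×ˢ Set.univ))
    (hd : ∀ x ∈ Metric.ball (0 : E) 1, ∀ ξ, HasFDerivAt (fun y => F y ξ) (F' x ξ) x)
    {x : E} (hx : x ∈ Metric.ball (0 : E) 1) :
    HasFDerivAt (fun y => ∫ ξ, F y ξ ∂μ) (∫ ξ, F' x ξ ∂μ) x := by
  -- Compactness of a small closed ball times the sphere bounds the derivative by a constant, which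
  -- serves as the dominating function.
  obtain ⟨ε, hε, hsub⟩ := Metric.nhds_basis_closedBall.mem_iff.1 (Metric.isOpen_ball.mem_nhds hx)
  have hK : IsCompact (Metric.closedBall x ε ×ˢ (Set.univ : Set (Metric.sphere (0 : E) 1))) :=
    (isCompact_closedBall x ε).prod isCompact_univ
  obtain ⟨C, hC⟩ := hK.exists_bound_of_continuousOn (hF'.mono (Set.prod_mono hsub subset_rfl))
  refine hasFDerivAt_integral_of_dominated_of_fderiv_le (bound := fun _ => C)
    (Metric.closedBall_mem_nhds x hε) ?_ ?_ ?_ ?_ ?_ ?_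
  · filter_upwards [Metric.isOpen_ball.mem_nhds hx] with y hy
    exact (hF y hy).aestronglyMeasurable
  · exact (hF x hx).integrable_of_hasCompactSupport (HasCompactSupport.of_compactSpace _)
  · have : Continuous (F' x) := by
      rw [← continuousOn_univ]
      exact hF'.comp (f := fun ξ => (x, ξ)) (by fun_prop) fun ξ _ => ⟨hx, trivial⟩
    exact this.aestronglyMeasurable
  · exact Filter.Eventually.of_forall fun ξ y hy => hC (y, ξ) ⟨hy, trivial⟩
  · exact MeasureTheory.integrable_const C
  · exact Filter.Eventually.of_forall fun ξ y hy => hd y (hsub hy) ξ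

/-- The action of a linear isometry on the unit sphere. -/
def sphereMap (R : E ≃ₗᵢ[ℝ] E) (ξ : Metric.sphere (0 : E) 1) : Metric.sphere (0 : E) 1 :=
  ⟨R ξ, by simp⟩

-- Up to the factor dim E, the surface measure of s is the volume of the cone (0,1)·s. A linear
-- isometry commutes with forming cones and preserves volume.
open scoped Pointwise in
theorem measurePreserving_sphereMap [MeasurableSpace E] [BorelSpace E] (R : E ≃ₗᵢ[ℝ] E) :
    MeasureTheory.MeasurePreserving (sphereMap R)
      (MeasureTheory.volume : MeasureTheory.Measure E).toSphere
      (MeasureTheory.volume : MeasureTheory.Measure E).toSphere := by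
  have hc : Continuous (sphereMap R) := by
    unfold sphereMap; fun_prop
  refine ⟨hc.measurable, ?_⟩
  ext s hs
  rw [MeasureTheory.Measure.map_apply hc.measurable hs,
    MeasureTheory.Measure.toSphere_apply' _ (hc.measurable hs),
    MeasureTheory.Measure.toSphere_apply' _ hs]
  congr 1
  rw [← MeasureTheory.MeasurePreserving.measure_preimage_equiv (f := R.toMeasurableEquiv)
    R.measurePreserving (Set.Ioo (0 : ℝ) 1 • (Subtype.val '' s))]
  congr 1
  ext z
  simp only [Set.mem_smul, Set.mem_preimage, Set.mem_image]
  constructor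
  · rintro ⟨t, ht, _, ⟨ξ, hξ, rfl⟩, rfl⟩
    exact ⟨t, ht, _, ⟨_, hξ, rfl⟩, by simp [sphereMap]⟩
  · rintro ⟨t, ht, _, ⟨ξ, hξ, rfl⟩, h⟩
    refine ⟨t, ht, _, ⟨sphereMap R.symm ξ, ?_, rfl⟩, ?_⟩
    · simpa [sphereMap] using hξ
    · apply R.injective
      simpa [sphereMap] using h

end General

/-! ### Derivatives and harmonicity of the Poisson kernel -/

section Poisson

theorem hasFDerivAt_inv_norm_sub_pow {E : Type*} [NormedAddCommGroup E] [InnerProductSpace ℝ E]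
    {ξ x : E} (h : x ≠ ξ) (k : ℕ) :
    HasFDerivAt (fun y => (‖y - ξ‖ ^ k)⁻¹)
      (-(k * (‖x - ξ‖ ^ (k + 2))⁻¹) • innerSL ℝ (x - ξ)) x := by
  have hN : ‖x - ξ‖ ≠ 0 := norm_ne_zero_iff.2 (sub_ne_zero.2 h)
  have h1 : HasFDerivAt (fun y => ‖y - ξ‖) (‖x - ξ‖⁻¹ • innerSL ℝ (x - ξ)) x := by
    have h2 := ((hasFDerivAt_id x).sub_const ξ).norm_sq.sqrt (pow_ne_zero 2 hN)
    simp only [id_eq, Real.sqrt_sq (norm_nonneg _)] at h2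
    refine h2.congr_fderiv ?_
    ext v
    simp
    field_simp
  have h3 := (hasDerivAt_inv (pow_ne_zero k hN)).comp_hasFDerivAt x (h1.pow k)
  refine h3.congr_fderiv ?_
  ext v
  -- The power rule produces the truncated exponent `k - 1`, so k = 0 is separate.
  rcases k with _ | k
  · simp
  · simp
    field_simp
    ring

variable {n : ℕ}

/-- The gradient of the Poisson kernel. -/
noncomputable def poissonGrad (ξ x : EuclideanSpace ℝ (Fin n)) : EuclideanSpace ℝ (Fin n) :=
  -(2 * (‖x - ξ‖ ^ n)⁻¹) • x - (n * (1 - ‖x‖ ^ 2) * (‖x - ξ‖ ^ (n + 2))⁻¹) • (x - ξ)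

/-- The Hessian of the Poisson kernel, applied to a vector `e`. -/
noncomputable def poissonHess (ξ x e : EuclideanSpace ℝ (Fin n)) : EuclideanSpace ℝ (Fin n) :=
  -(2 * (‖x - ξ‖ ^ n)⁻¹ + n * (1 - ‖x‖ ^ 2) * (‖x - ξ‖ ^ (n + 2))⁻¹) • e +
    (2 * n * inner ℝ x e * (‖x - ξ‖ ^ (n + 2))⁻¹ +
      n * (n + 2) * (1 - ‖x‖ ^ 2) * inner ℝ (x - ξ) e * (‖x - ξ‖ ^ (n + 4))⁻¹) • (x - ξ) +
    (2 * n * inner ℝ (x - ξ) e * (‖x - ξ‖ ^ (n + 2))⁻¹) • x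

theorem hasFDerivAt_poisson {ξ x : EuclideanSpace ℝ (Fin n)} (h : x ≠ ξ) :
    HasFDerivAt (poisson ξ) (innerSL ℝ (poissonGrad ξ x)) x := by
  have h1 := ((hasFDerivAt_id x).norm_sq.const_sub 1).mul (hasFDerivAt_inv_norm_sub_pow h n)
  refine (h1.congr_fderiv ?_).congr_of_eventuallyEq (Filter.Eventually.of_forall fun y => ?_)
  · ext v
    simp [poissonGrad]
    ring
  · simp [poisson, div_eq_mul_inv]

theorem hasFDerivAt_inner_poissonGrad {ξ x : EuclideanSpace ℝ (Fin n)} (h : x ≠ ξ)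
    (e : EuclideanSpace ℝ (Fin n)) :
    HasFDerivAt (fun y => innerSL ℝ (poissonGrad ξ y) e) (innerSL ℝ (poissonHess ξ x e)) x := by
  have hA := (hasFDerivAt_id x).norm_sq.const_sub 1
  have hx : HasFDerivAt (fun y : EuclideanSpace ℝ (Fin n) => inner ℝ y e)
      (innerSL ℝ e) x := by
    refine (innerSL ℝ e).hasFDerivAt.congr_of_eventuallyEq
      (Filter.Eventually.of_forall fun y => ?_)
    simp [real_inner_comm]
  have hy : HasFDerivAt (fun y : EuclideanSpace ℝ (Fin n) => inner ℝ (y - ξ) e)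
      (innerSL ℝ e) x := by
    simpa [inner_sub_left] using hx.sub_const (inner ℝ ξ e)
  have h1 := (((hasFDerivAt_inv_norm_sub_pow h n).mul hx).const_mul (-2)).sub
    (((hA.mul (hasFDerivAt_inv_norm_sub_pow h (n + 2))).mul hy).const_mul (n : ℝ))
  refine (h1.congr_fderiv ?_).congr_of_eventuallyEq (Filter.Eventually.of_forall fun y => ?_)
  · ext v
    simp [poissonHess, inner_sub_left]
    ring
  · simp [poissonGrad, inner_sub_left]
    ring

/-- By Parseval the trace equals `2n |x - ξ|^(-n-2) (1 + |x|² - 2⟨x, ξ⟩ - |x - ξ|²)`, and the last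
factor vanishes because |ξ| = 1. -/
theorem sum_inner_poissonHess {ξ x : EuclideanSpace ℝ (Fin n)} (hξ : ‖ξ‖ = 1) (h : x ≠ ξ) :
    ∑ i, inner ℝ (poissonHess ξ x (stdOrthonormalBasis ℝ (EuclideanSpace ℝ (Fin n)) i))
      (stdOrthonormalBasis ℝ (EuclideanSpace ℝ (Fin n)) i) = (0 : ℝ) := by
  set b := stdOrthonormalBasis ℝ (EuclideanSpace ℝ (Fin n)) with hb
  have hN : ‖x - ξ‖ ≠ 0 := norm_ne_zero_iff.2 (sub_ne_zero.2 h)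
  have hsum : ∀ u v : EuclideanSpace ℝ (Fin n),
      ∑ i, inner ℝ u (b i) * inner ℝ v (b i) = inner ℝ u v := fun u v => by
    rw [← b.sum_inner_mul_inner u v]
    exact Finset.sum_congr rfl fun i _ => by rw [real_inner_comm v]
  have hN2 : ‖x - ξ‖ ^ 2 = ‖x‖ ^ 2 - 2 * inner ℝ x ξ + 1 := by
    rw [norm_sub_sq_real, hξ]; ring
  have hxy : inner ℝ x (x - ξ) = ‖x‖ ^ 2 - inner ℝ x ξ := by
    rw [inner_sub_right, real_inner_self_eq_norm_sq]
  have e1 : ∀ i, inner ℝ (poissonHess ξ x (b i)) (b i) =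
      -(2 * (‖x - ξ‖ ^ n)⁻¹ + n * (1 - ‖x‖ ^ 2) * (‖x - ξ‖ ^ (n + 2))⁻¹) +
      4 * n * (‖x - ξ‖ ^ (n + 2))⁻¹ * (inner ℝ x (b i) * inner ℝ (x - ξ) (b i)) +
      n * (n + 2) * (1 - ‖x‖ ^ 2) * (‖x - ξ‖ ^ (n + 4))⁻¹ *
        (inner ℝ (x - ξ) (b i) * inner ℝ (x - ξ) (b i)) := fun i => by
    have : inner ℝ (b i) (b i) = (1 : ℝ) := by
      rw [real_inner_self_eq_norm_sq, b.norm_eq_one]; norm_num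
    simp only [poissonHess, inner_add_left, real_inner_smul_left, this]
    ring
  simp_rw [e1]
  rw [Finset.sum_add_distrib, Finset.sum_add_distrib, ← Finset.mul_sum, ← Finset.mul_sum, hsum,
    hsum, hxy, real_inner_self_eq_norm_sq]
  simp only [Finset.sum_const, Finset.card_univ, Fintype.card_fin, finrank_euclideanSpace,
    nsmul_eq_mul]
  have hx2 : ‖x‖ ^ 2 = ‖x - ξ‖ ^ 2 + 2 * inner ℝ x ξ - 1 := by linarith
  rw [hx2]
  field_simp
  ring

theorem ne_of_mem_ball_of_mem_sphere {x ξ : EuclideanSpace ℝ (Fin n)}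
    (hx : x ∈ Metric.ball (0 : EuclideanSpace ℝ (Fin n)) 1) (hξ : ‖ξ‖ = 1) : x ≠ ξ := by
  rintro rfl
  rw [mem_ball_zero_iff, hξ] at hx
  exact lt_irrefl _ hx

theorem poisson_pos {x ξ : EuclideanSpace ℝ (Fin n)}
    (hx : x ∈ Metric.ball (0 : EuclideanSpace ℝ (Fin n)) 1) (hξ : ‖ξ‖ = 1) :
    0 < poisson ξ x := by
  have h1 : 0 < ‖x - ξ‖ := norm_pos_iff.2 (sub_ne_zero.2 (ne_of_mem_ball_of_mem_sphere hx hξ))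
  rw [mem_ball_zero_iff] at hx
  have : 0 < 1 - ‖x‖ ^ 2 := by nlinarith [norm_nonneg x]
  unfold poisson
  positivity

theorem contDiffAt_poisson {ξ x : EuclideanSpace ℝ (Fin n)} (h : x ≠ ξ) :
    ContDiffAt ℝ 2 (poisson ξ) x := by
  have hN : x - ξ ≠ 0 := sub_ne_zero.2 h
  have h1 : ContDiffAt ℝ 2 (fun y => ‖y - ξ‖) x :=
    (contDiffAt_norm ℝ hN).comp x (contDiffAt_id.sub contDiffAt_const)
  exact (contDiffAt_const.sub (contDiff_norm_sq ℝ).contDiffAt).div (h1.pow n)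
    (pow_ne_zero n (norm_ne_zero_iff.2 hN))

theorem harmonicOnNhd_poisson {ξ : EuclideanSpace ℝ (Fin n)} (hξ : ‖ξ‖ = 1) :
    InnerProductSpace.HarmonicOnNhd (poisson ξ) (Metric.ball 0 1) := by
  intro x hx
  refine ⟨contDiffAt_poisson (ne_of_mem_ball_of_mem_sphere hx hξ), ?_⟩
  filter_upwards [Metric.isOpen_ball.mem_nhds hx] with y hy
  have hne := ne_of_mem_ball_of_mem_sphere hy hξ
  rw [laplacian_eq_sum_fderiv (contDiffAt_poisson hne)]
  refine Eq.trans (Finset.sum_congr rfl fun i _ => ?_) (sum_inner_poissonHess hξ hne)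
  have : (fun z => fderiv ℝ (poisson ξ) z (stdOrthonormalBasis ℝ (EuclideanSpace ℝ (Fin n)) i))
      =ᶠ[nhds y] fun z => innerSL ℝ (poissonGrad ξ z)
        (stdOrthonormalBasis ℝ (EuclideanSpace ℝ (Fin n)) i) := by
    filter_upwards [Metric.isOpen_ball.mem_nhds hy] with z hz
    rw [(hasFDerivAt_poisson (ne_of_mem_ball_of_mem_sphere hz hξ)).fderiv]
  rw [this.fderiv_eq, (hasFDerivAt_inner_poissonGrad hne _).fderiv]
  rfl

end Poisson

/-! ### Poisson integrals and the Poisson formula -/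

section PoissonIntegral

open MeasureTheory

variable {n : ℕ}

/-- The surface measure of the unit sphere. -/
noncomputable def sphereMeasure (n : ℕ) :
    Measure (Metric.sphere (0 : EuclideanSpace ℝ (Fin n)) 1) :=
  (volume : Measure (EuclideanSpace ℝ (Fin n))).toSphere

instance : IsFiniteMeasure (sphereMeasure n) := by
  unfold sphereMeasure; infer_instance

theorem integrable_sphereMeasure {g : Metric.sphere (0 : EuclideanSpace ℝ (Fin n)) 1 → ℝ}
    (hg : Continuous g) : Integrable g (sphereMeasure n) :=
  hg.integrable_of_hasCompactSupport (HasCompactSupport.of_compactSpace _)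

theorem sphereMeasure_real_univ_pos [NeZero n] : 0 < (sphereMeasure n).real Set.univ := by
  have : Nontrivial (EuclideanSpace ℝ (Fin n)) :=
    (Module.finrank_pos_iff (R := ℝ)).1 (by simpa using NeZero.pos n)
  rw [measureReal_def, ENNReal.toReal_pos_iff]
  refine ⟨?_, measure_lt_top _ _⟩
  rw [pos_iff_ne_zero, Ne, Measure.measure_univ_eq_zero]
  exact Measure.toSphere_ne_zero _

theorem norm_sub_ne_zero_of_mem {p : EuclideanSpace ℝ (Fin n) ×
      Metric.sphere (0 : EuclideanSpace ℝ (Fin n)) 1}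
    (hp : p ∈ Metric.ball (0 : EuclideanSpace ℝ (Fin n)) 1 ×ˢ Set.univ) :
    ‖p.1 - (p.2 : EuclideanSpace ℝ (Fin n))‖ ≠ 0 :=
  norm_ne_zero_iff.2 (sub_ne_zero.2
    (ne_of_mem_ball_of_mem_sphere hp.1 (norm_eq_of_mem_sphere p.2)))

theorem continuousOn_poissonGrad : ContinuousOn
    (fun p : EuclideanSpace ℝ (Fin n) × Metric.sphere (0 : EuclideanSpace ℝ (Fin n)) 1 =>
      poissonGrad (p.2 : EuclideanSpace ℝ (Fin n)) p.1) (Metric.ball 0 1 ×ˢ Set.univ) := by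
  have h : ∀ k : ℕ, ContinuousOn
      (fun p : EuclideanSpace ℝ (Fin n) × Metric.sphere (0 : EuclideanSpace ℝ (Fin n)) 1 =>
      (‖p.1 - (p.2 : EuclideanSpace ℝ (Fin n))‖ ^ k)⁻¹) (Metric.ball 0 1 ×ˢ Set.univ) := fun k =>
    ContinuousOn.inv₀ (by fun_prop) fun p hp => pow_ne_zero k (norm_sub_ne_zero_of_mem hp)
  have h1 := h n
  have h2 := h (n + 2)
  unfold poissonGrad
  fun_prop

theorem continuousOn_poissonHess (e : EuclideanSpace ℝ (Fin n)) : ContinuousOn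
    (fun p : EuclideanSpace ℝ (Fin n) × Metric.sphere (0 : EuclideanSpace ℝ (Fin n)) 1 =>
      poissonHess (p.2 : EuclideanSpace ℝ (Fin n)) p.1 e) (Metric.ball 0 1 ×ˢ Set.univ) := by
  have h : ∀ k : ℕ, ContinuousOn
      (fun p : EuclideanSpace ℝ (Fin n) × Metric.sphere (0 : EuclideanSpace ℝ (Fin n)) 1 =>
      (‖p.1 - (p.2 : EuclideanSpace ℝ (Fin n))‖ ^ k)⁻¹) (Metric.ball 0 1 ×ˢ Set.univ) := fun k =>
    ContinuousOn.inv₀ (by fun_prop) fun p hp => pow_ne_zero k (norm_sub_ne_zero_of_mem hp)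
  have h1 := h n
  have h2 := h (n + 2)
  have h4 := h (n + 4)
  unfold poissonHess
  fun_prop

theorem continuous_poisson_sphere {x : EuclideanSpace ℝ (Fin n)}
    (hx : x ∈ Metric.ball (0 : EuclideanSpace ℝ (Fin n)) 1) :
    Continuous fun ξ : Metric.sphere (0 : EuclideanSpace ℝ (Fin n)) 1 =>
      poisson (ξ : EuclideanSpace ℝ (Fin n)) x := by
  unfold poisson
  refine Continuous.div (by fun_prop) (by fun_prop) fun ξ => pow_ne_zero n ?_
  exact norm_sub_ne_zero_of_mem (p := (x, ξ)) ⟨hx, trivial⟩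

/-- The (unnormalized) Poisson integral of a function on the unit sphere. -/
noncomputable def poissonIntegral (g : Metric.sphere (0 : EuclideanSpace ℝ (Fin n)) 1 → ℝ)
    (x : EuclideanSpace ℝ (Fin n)) : ℝ :=
  ∫ ξ, g ξ * poisson (ξ : EuclideanSpace ℝ (Fin n)) x ∂(sphereMeasure n)

theorem continuousOn_smul_innerSL_poissonGrad
    {g : Metric.sphere (0 : EuclideanSpace ℝ (Fin n)) 1 → ℝ}
    (hg : Continuous g) : ContinuousOn
    (fun p : EuclideanSpace ℝ (Fin n) × Metric.sphere (0 : EuclideanSpace ℝ (Fin n)) 1 =>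
      g p.2 • innerSL ℝ (poissonGrad (p.2 : EuclideanSpace ℝ (Fin n)) p.1))
    (Metric.ball 0 1 ×ˢ Set.univ) := by
  have := continuousOn_poissonGrad (n := n)
  exact (hg.comp continuous_snd).continuousOn.smul ((innerSL ℝ).continuous.comp_continuousOn this)

theorem continuousOn_smul_innerSL_poissonHess
    {g : Metric.sphere (0 : EuclideanSpace ℝ (Fin n)) 1 → ℝ}
    (hg : Continuous g) (e : EuclideanSpace ℝ (Fin n)) : ContinuousOn
    (fun p : EuclideanSpace ℝ (Fin n) × Metric.sphere (0 : EuclideanSpace ℝ (Fin n)) 1 =>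
      g p.2 • innerSL ℝ (poissonHess (p.2 : EuclideanSpace ℝ (Fin n)) p.1 e))
    (Metric.ball 0 1 ×ˢ Set.univ) := by
  have := continuousOn_poissonHess e
  exact (hg.comp continuous_snd).continuousOn.smul ((innerSL ℝ).continuous.comp_continuousOn this)

theorem integrable_of_continuousOn_prod {F : Type*} [NormedAddCommGroup F]
    {φ : EuclideanSpace ℝ (Fin n) → Metric.sphere (0 : EuclideanSpace ℝ (Fin n)) 1 → F}
    (hφ : ContinuousOn (fun p : EuclideanSpace ℝ (Fin n) ×
      Metric.sphere (0 : EuclideanSpace ℝ (Fin n)) 1 => φ p.1 p.2) (Metric.ball 0 1 ×ˢ Set.univ))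
    {x : EuclideanSpace ℝ (Fin n)} (hx : x ∈ Metric.ball (0 : EuclideanSpace ℝ (Fin n)) 1) :
    Integrable (φ x) (sphereMeasure n) := by
  have : Continuous (φ x) := by
    rw [← continuousOn_univ]
    exact hφ.comp (f := fun ξ => (x, ξ)) (by fun_prop) fun ξ _ => ⟨hx, trivial⟩
  exact this.integrable_of_hasCompactSupport (HasCompactSupport.of_compactSpace _)

theorem hasFDerivAt_poissonIntegral
    {g : Metric.sphere (0 : EuclideanSpace ℝ (Fin n)) 1 → ℝ}
    (hg : Continuous g) {x : EuclideanSpace ℝ (Fin n)}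
    (hx : x ∈ Metric.ball (0 : EuclideanSpace ℝ (Fin n)) 1) :
    HasFDerivAt (poissonIntegral g) (∫ ξ, g ξ • innerSL ℝ (poissonGrad
      (ξ : EuclideanSpace ℝ (Fin n)) x) ∂(sphereMeasure n)) x := by
  refine hasFDerivAt_integral_sphere _ (fun y hy => hg.mul (continuous_poisson_sphere hy))
    (F' := fun x ξ => g ξ • innerSL ℝ (poissonGrad (ξ : EuclideanSpace ℝ (Fin n)) x))
    (continuousOn_smul_innerSL_poissonGrad hg) (fun y hy ξ => ?_) hx
  exact (hasFDerivAt_poisson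
    (ne_of_mem_ball_of_mem_sphere hy (norm_eq_of_mem_sphere ξ))).const_mul (g ξ)

theorem integral_smul_innerSL_poissonGrad_apply
    {g : Metric.sphere (0 : EuclideanSpace ℝ (Fin n)) 1 → ℝ}
    (hg : Continuous g) {x : EuclideanSpace ℝ (Fin n)}
    (hx : x ∈ Metric.ball (0 : EuclideanSpace ℝ (Fin n)) 1) (v : EuclideanSpace ℝ (Fin n)) :
    (∫ ξ, g ξ • innerSL ℝ (poissonGrad (ξ : EuclideanSpace ℝ (Fin n)) x) ∂(sphereMeasure n)) v =
      ∫ ξ, g ξ * innerSL ℝ (poissonGrad (ξ : EuclideanSpace ℝ (Fin n)) x) v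
        ∂(sphereMeasure n) := by
  rw [ContinuousLinearMap.integral_apply (integrable_of_continuousOn_prod
    (φ := fun x ξ => g ξ • innerSL ℝ (poissonGrad (ξ : EuclideanSpace ℝ (Fin n)) x))
    (continuousOn_smul_innerSL_poissonGrad hg) hx)]
  rfl

/-- The kernel may be differentiated twice under the integral, and its Hessian is traceless for each
ξ. `IsDirHarmonic` asks only for scalar derivatives along basis vectors, so no continuity of the
second derivatives of the integral has to be proved. -/
theorem isDirHarmonic_poissonIntegral
    {g : Metric.sphere (0 : EuclideanSpace ℝ (Fin n)) 1 → ℝ}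
    (hg : Continuous g) : IsDirHarmonic (poissonIntegral g) := by
  refine ⟨_, fun i x => ∫ ξ, g ξ • innerSL ℝ (poissonHess (ξ : EuclideanSpace ℝ (Fin n)) x
      (stdOrthonormalBasis ℝ (EuclideanSpace ℝ (Fin n)) i)) ∂(sphereMeasure n),
    fun x hx => hasFDerivAt_poissonIntegral hg hx, fun i x hx => ?_, fun x hx => ?_⟩
  · set e := stdOrthonormalBasis ℝ (EuclideanSpace ℝ (Fin n)) i
    have h1 := hasFDerivAt_integral_sphere (sphereMeasure n)
      (F := fun y ξ => g ξ * innerSL ℝ (poissonGrad (ξ : EuclideanSpace ℝ (Fin n)) y) e)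
      (F' := fun x ξ => g ξ • innerSL ℝ (poissonHess (ξ : EuclideanSpace ℝ (Fin n)) x e))
      (fun y hy => ?_) (continuousOn_smul_innerSL_poissonHess hg e) (fun y hy ξ => ?_) hx
    · refine h1.congr_of_eventuallyEq ?_
      filter_upwards [Metric.isOpen_ball.mem_nhds hx] with y hy
      exact integral_smul_innerSL_poissonGrad_apply hg hy e
    · have : Continuous fun ξ : Metric.sphere (0 : EuclideanSpace ℝ (Fin n)) 1 =>
          poissonGrad (ξ : EuclideanSpace ℝ (Fin n)) y := by
        rw [← continuousOn_univ]
        exact continuousOn_poissonGrad.comp (f := fun ξ => (y, ξ)) (by fun_prop)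
          fun ξ _ => ⟨hy, trivial⟩
      simp only [innerSL_apply_apply]
      fun_prop
    · exact (hasFDerivAt_inner_poissonGrad
        (ne_of_mem_ball_of_mem_sphere hy (norm_eq_of_mem_sphere ξ)) e).const_mul (g ξ)
  · have hi : ∀ i, Integrable (fun ξ : Metric.sphere (0 : EuclideanSpace ℝ (Fin n)) 1 =>
        g ξ • innerSL ℝ (poissonHess (ξ : EuclideanSpace ℝ (Fin n)) x
          (stdOrthonormalBasis ℝ (EuclideanSpace ℝ (Fin n)) i))) (sphereMeasure n) := fun i =>
      integrable_of_continuousOn_prod (φ := fun x ξ => g ξ • innerSL ℝ (poissonHess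
        (ξ : EuclideanSpace ℝ (Fin n)) x _)) (continuousOn_smul_innerSL_poissonHess hg _) hx
    simp_rw [ContinuousLinearMap.integral_apply (hi _)]
    rw [← integral_finsetSum _ fun i _ => (hi i).apply_continuousLinearMap _]
    refine integral_eq_zero_of_ae (Filter.Eventually.of_forall fun ξ => ?_)
    simp only [smul_apply, innerSL_apply_apply, smul_eq_mul, ← Finset.mul_sum]
    rw [sum_inner_poissonHess (norm_eq_of_mem_sphere ξ)
      (ne_of_mem_ball_of_mem_sphere hx (norm_eq_of_mem_sphere ξ))]
    simp

/-- The reflection in the hyperplane orthogonal to x - y sends x to y and preserves both the surface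
measure and the distances in the kernel. -/
theorem poissonIntegral_one_eq_of_norm_eq {x y : EuclideanSpace ℝ (Fin n)} (h : ‖x‖ = ‖y‖) :
    poissonIntegral (fun _ => 1) x = poissonIntegral (fun _ => 1) y := by
  let R : EuclideanSpace ℝ (Fin n) ≃ₗᵢ[ℝ] EuclideanSpace ℝ (Fin n) :=
    (Submodule.span ℝ {x - y})ᗮ.reflection
  have hR : R x = y := Submodule.reflection_sub h
  have hmp : MeasurePreserving (sphereMap R) (sphereMeasure n) (sphereMeasure n) :=
    measurePreserving_sphereMap R
  have hm : Measurable fun ξ : Metric.sphere (0 : EuclideanSpace ℝ (Fin n)) 1 =>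
      (1 : ℝ) * poisson (ξ : EuclideanSpace ℝ (Fin n)) y := by
    unfold poisson; fun_prop
  unfold poissonIntegral
  conv_rhs => rw [← hmp.map_eq]
  rw [integral_map hmp.measurable.aemeasurable hm.aestronglyMeasurable]
  refine integral_congr_ae (Filter.Eventually.of_forall fun ξ => ?_)
  simp only [sphereMap, poisson, h]
  rw [← hR, ← map_sub, R.norm_map, R.norm_map]

/-- The integral is harmonic and constant on the sphere through x, so the maximum principle for it
and for its negative gives the same value at 0, where the kernel is 1. -/
theorem poissonIntegral_one [NeZero n] {x : EuclideanSpace ℝ (Fin n)}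
    (hx : x ∈ Metric.ball (0 : EuclideanSpace ℝ (Fin n)) 1) :
    poissonIntegral (fun _ => 1) x = (sphereMeasure n).real Set.univ := by
  have : Nontrivial (EuclideanSpace ℝ (Fin n)) :=
    (Module.finrank_pos_iff (R := ℝ)).1 (by simpa using NeZero.pos n)
  have hh : IsDirHarmonic (poissonIntegral (n := n) fun _ => 1) :=
    isDirHarmonic_poissonIntegral continuous_const
  rw [mem_ball_zero_iff] at hx
  have h0 : poissonIntegral (n := n) (fun _ => 1) 0 = (sphereMeasure n).real Set.univ := by
    simp [poissonIntegral, poisson]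
  have h1 := hh.le_of_le_sphere hx (M := poissonIntegral (fun _ => 1) x)
    (fun y hy => (poissonIntegral_one_eq_of_norm_eq hy).le) (x := 0) (by simp)
  have h2 := (hh.const_mul (-1)).le_of_le_sphere hx (M := -1 * poissonIntegral (fun _ => 1) x)
    (fun y hy => by rw [poissonIntegral_one_eq_of_norm_eq hy]) (x := 0) (by simp)
  linarith

/-- The Poisson formula. -/
theorem poissonIntegral_eq [NeZero n] {f : EuclideanSpace ℝ (Fin n) → ℝ} (hf : IsDirHarmonic f)
    (hc : ContinuousOn f (Metric.closedBall 0 1)) {x : EuclideanSpace ℝ (Fin n)}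
    (hx : x ∈ Metric.ball (0 : EuclideanSpace ℝ (Fin n)) 1) :
    poissonIntegral (fun ξ => f ξ) x = (sphereMeasure n).real Set.univ * f x := by
  have : Nontrivial (EuclideanSpace ℝ (Fin n)) :=
    (Module.finrank_pos_iff (R := ℝ)).1 (by simpa using NeZero.pos n)
  set c := (sphereMeasure n).real Set.univ with hcdef
  have hc0 : 0 < c := sphereMeasure_real_univ_pos
  have hfs : Continuous fun ξ : Metric.sphere (0 : EuclideanSpace ℝ (Fin n)) 1 => f ξ := by
    rw [← continuousOn_univ]
    exact hc.comp (by fun_prop) fun ξ _ => Metric.sphere_subset_closedBall ξ.2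
  -- By the maximum principle it suffices that w is small on spheres of radius close to 1; boundary
  -- values of the Poisson integral itself are never needed.
  let w : EuclideanSpace ℝ (Fin n) → ℝ := fun y => poissonIntegral (fun ξ => f ξ) y - c * f y
  have hw : IsDirHarmonic w := (isDirHarmonic_poissonIntegral hfs).sub (hf.const_mul c)
  have hK : IsCompact (Metric.closedBall (0 : EuclideanSpace ℝ (Fin n)) 1) :=
    isCompact_closedBall _ _
  obtain ⟨M, hM⟩ := hK.exists_bound_of_continuousOn hc
  have hM0 : 0 ≤ M := (norm_nonneg _).trans (hM 0 (by simp))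
  have huc := Metric.uniformContinuousOn_iff.1 (hK.uniformContinuousOn_of_continuous hc)
  -- The integrand of w y is at most ε times the kernel when ξ is δ-close to y, by uniform
  -- continuity, and at most 2M(1 - ρ²)/δⁿ < ε otherwise. Each of the two bounds integrates to ε c.
  have bound : ∀ ε > 0, |w x| ≤ 2 * ε * c := by
    intro ε hε
    obtain ⟨δ, hδ, hfδ⟩ := huc ε hε
    have hlim : Filter.Tendsto (fun ρ : ℝ => 2 * M * (1 - ρ ^ 2) / δ ^ n) (nhds 1) (nhds 0) := by
      have : Continuous fun ρ : ℝ => 2 * M * (1 - ρ ^ 2) / δ ^ n := by fun_prop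
      simpa using this.tendsto 1
    have hev : ∀ᶠ ρ : ℝ in nhdsWithin 1 (Set.Iio 1),
        2 * M * (1 - ρ ^ 2) / δ ^ n < ε ∧ ‖x‖ < ρ ∧ ρ < 1 :=
      (((hlim.eventually (gt_mem_nhds hε)).filter_mono nhdsWithin_le_nhds).and
        (((lt_mem_nhds (by simpa using hx)).filter_mono nhdsWithin_le_nhds).and
          self_mem_nhdsWithin))
    obtain ⟨ρ, hρε, hxρ, hρ1⟩ := hev.exists
    have hρ0 : 0 ≤ ρ := (norm_nonneg x).trans hxρ.le
    have hsphere : ∀ y : EuclideanSpace ℝ (Fin n), ‖y‖ = ρ → |w y| ≤ 2 * ε * c := by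
      intro y hy
      have hyb : y ∈ Metric.ball (0 : EuclideanSpace ℝ (Fin n)) 1 := by simpa [hy] using hρ1
      have hP := continuous_poisson_sphere hyb
      have hwy : w y = ∫ ξ : Metric.sphere (0 : EuclideanSpace ℝ (Fin n)) 1,
          (f ξ - f y) * poisson (ξ : EuclideanSpace ℝ (Fin n)) y ∂(sphereMeasure n) := by
        have h1 : c * f y = ∫ ξ : Metric.sphere (0 : EuclideanSpace ℝ (Fin n)) 1,
            f y * poisson (ξ : EuclideanSpace ℝ (Fin n)) y ∂(sphereMeasure n) := by
          rw [integral_const_mul, hcdef, ← poissonIntegral_one hyb, poissonIntegral]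
          simp [mul_comm]
        simp only [w]
        rw [h1, poissonIntegral]
        refine (integral_sub (integrable_sphereMeasure (hfs.mul hP))
          (integrable_sphereMeasure (continuous_const.mul hP))).symm.trans ?_
        simp only [Pi.mul_apply, sub_mul]
      have hpt : ∀ ξ : Metric.sphere (0 : EuclideanSpace ℝ (Fin n)) 1,
          ‖(f ξ - f y) * poisson (ξ : EuclideanSpace ℝ (Fin n)) y‖ ≤
            ε * (1 * poisson (ξ : EuclideanSpace ℝ (Fin n)) y) + ε := by
        intro ξ
        have hpp := poisson_pos hyb (norm_eq_of_mem_sphere ξ)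
        have hξ : (ξ : EuclideanSpace ℝ (Fin n)) ∈
          Metric.closedBall (0 : EuclideanSpace ℝ (Fin n)) 1 := Metric.sphere_subset_closedBall ξ.2
        have hyc := Metric.ball_subset_closedBall hyb
        rw [norm_mul, Real.norm_of_nonneg hpp.le]
        rcases lt_or_ge (dist (ξ : EuclideanSpace ℝ (Fin n)) y) δ with hd | hd
        · have := hfδ _ hξ _ hyc hd
          rw [Real.dist_eq] at this
          rw [Real.norm_eq_abs]
          nlinarith
        · have h2 : ‖f ξ - f y‖ ≤ 2 * M := by
            have := norm_sub_le (f ξ) (f y)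
            linarith [hM _ hξ, hM _ hyc]
          have h3 : poisson (ξ : EuclideanSpace ℝ (Fin n)) y ≤ (1 - ρ ^ 2) / δ ^ n := by
            unfold poisson
            rw [hy, ← dist_eq_norm, dist_comm]
            have : 0 ≤ 1 - ρ ^ 2 := by nlinarith
            gcongr
          calc ‖f ξ - f y‖ * poisson (ξ : EuclideanSpace ℝ (Fin n)) y
              ≤ 2 * M * ((1 - ρ ^ 2) / δ ^ n) := by gcongr
            _ ≤ ε := by rw [← mul_div_assoc]; exact hρε.le
            _ ≤ _ := by nlinarith
      rw [hwy, ← Real.norm_eq_abs]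
      refine (norm_integral_le_of_norm_le (integrable_sphereMeasure (by fun_prop))
        (Filter.Eventually.of_forall hpt)).trans ?_
      rw [integral_add (integrable_sphereMeasure (by fun_prop))
        (integrable_sphereMeasure continuous_const), integral_const_mul]
      have := poissonIntegral_one hyb
      rw [poissonIntegral] at this
      rw [this, integral_const, smul_eq_mul]
      linarith
    rw [abs_le]
    constructor
    · have := (hw.const_mul (-1)).le_of_le_sphere hρ1 (M := 2 * ε * c)
        (fun y hy => by linarith [(abs_le.1 (hsphere y hy)).1]) hxρ.le
      linarith
    · exact hw.le_of_le_sphere hρ1 (fun y hy => (abs_le.1 (hsphere y hy)).2) hxρ.le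
  have hw0 : |w x| ≤ 0 := by
    refine le_of_forall_pos_le_add fun ε hε => ?_
    have := bound (ε / (2 * c)) (by positivity)
    rwa [show 2 * (ε / (2 * c)) * c = 0 + ε by field_simp; ring] at this
  have := abs_nonpos_iff.1 hw0
  exact sub_eq_zero.1 this

end PoissonIntegral

/-! ### Möbius transformations and the two kernel identities -/

section Mobius

variable {n : ℕ} {a x ξ : EuclideanSpace ℝ (Fin n)}

theorem one_sub_norm_sq_pos (ha : a ∈ Metric.ball (0 : EuclideanSpace ℝ (Fin n)) 1) :
    0 < 1 - ‖a‖ ^ 2 := by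
  rw [mem_ball_zero_iff] at ha
  nlinarith [norm_nonneg a]

theorem bracket_sq_pos (ha : a ∈ Metric.ball (0 : EuclideanSpace ℝ (Fin n)) 1) (hx : ‖x‖ ≤ 1) :
    0 < 1 + ‖a‖ ^ 2 * ‖x‖ ^ 2 - 2 * inner ℝ a x := by
  rw [mem_ball_zero_iff] at ha
  have h1 := real_inner_le_norm a x
  have h2 : ‖a‖ * ‖x‖ < 1 := by nlinarith [norm_nonneg a, norm_nonneg x]
  nlinarith [sq_nonneg (1 - ‖a‖ * ‖x‖), mul_pos (sub_pos.2 h2) (sub_pos.2 h2)]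

theorem bracket_sq (ha : a ∈ Metric.ball (0 : EuclideanSpace ℝ (Fin n)) 1) (hx : ‖x‖ ≤ 1) :
    bracket x a ^ 2 = 1 + ‖a‖ ^ 2 * ‖x‖ ^ 2 - 2 * inner ℝ a x :=
  Real.sq_sqrt (bracket_sq_pos ha hx).le

theorem bracket_pos (ha : a ∈ Metric.ball (0 : EuclideanSpace ℝ (Fin n)) 1) (hx : ‖x‖ ≤ 1) :
    0 < bracket x a :=
  Real.sqrt_pos.2 (bracket_sq_pos ha hx)

theorem bracket_sq_of_norm_eq_one (ha : a ∈ Metric.ball (0 : EuclideanSpace ℝ (Fin n)) 1)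
    (hξ : ‖ξ‖ = 1) : bracket ξ a ^ 2 = ‖a - ξ‖ ^ 2 := by
  rw [bracket_sq ha hξ.le, norm_sub_sq_real, hξ]
  ring

theorem norm_sub_pos (ha : a ∈ Metric.ball (0 : EuclideanSpace ℝ (Fin n)) 1) (hξ : ‖ξ‖ = 1) :
    0 < ‖a - ξ‖ :=
  norm_pos_iff.2 (sub_ne_zero.2 (ne_of_mem_ball_of_mem_sphere ha hξ))

/-- On the sphere [ξ, a] = |a - ξ|. Geometrically, φ_a sends ξ to the other end of the chord through
ξ and a. -/
theorem mobius_of_norm_eq_one (ha : a ∈ Metric.ball (0 : EuclideanSpace ℝ (Fin n)) 1)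
    (hξ : ‖ξ‖ = 1) : mobius a ξ = a + ((1 - ‖a‖ ^ 2) / ‖a - ξ‖ ^ 2) • (a - ξ) := by
  have := norm_sub_pos ha hξ
  rw [mobius, bracket_sq_of_norm_eq_one ha hξ, smul_add, smul_smul, smul_smul,
    inv_mul_cancel₀ (by positivity), one_smul, add_comm, div_eq_inv_mul]

theorem mobius_eq_smul_sub_smul (ha : a ∈ Metric.ball (0 : EuclideanSpace ℝ (Fin n)) 1)
    (hx : ‖x‖ ≤ 1) : mobius a x = (1 + ‖a‖ ^ 2 * ‖x‖ ^ 2 - 2 * inner ℝ a x)⁻¹ •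
      ((1 - 2 * inner ℝ a x + ‖x‖ ^ 2) • a - (1 - ‖a‖ ^ 2) • x) := by
  rw [mobius, bracket_sq ha hx, norm_sub_sq_real]
  congr 1
  module

theorem norm_mobius_sq (ha : a ∈ Metric.ball (0 : EuclideanSpace ℝ (Fin n)) 1) (hx : ‖x‖ ≤ 1) :
    1 - ‖mobius a x‖ ^ 2 = (1 - ‖a‖ ^ 2) * (1 - ‖x‖ ^ 2) / bracket x a ^ 2 := by
  have hB := (bracket_sq_pos ha hx).ne'
  rw [mobius_eq_smul_sub_smul ha hx, bracket_sq ha hx, norm_smul, mul_pow, Real.norm_eq_abs,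
    sq_abs, norm_sub_sq_real, norm_smul, norm_smul, mul_pow, mul_pow, Real.norm_eq_abs,
    Real.norm_eq_abs, sq_abs, sq_abs, real_inner_smul_left, real_inner_smul_right]
  field_simp
  ring

theorem norm_mobius_of_norm_eq_one (ha : a ∈ Metric.ball (0 : EuclideanSpace ℝ (Fin n)) 1)
    (hξ : ‖ξ‖ = 1) : ‖mobius a ξ‖ = 1 := by
  have h := norm_mobius_sq ha hξ.le
  rw [hξ] at h
  have h2 : ‖mobius a ξ‖ ^ 2 = 1 := by simp at h; linarith
  exact (pow_eq_one_iff_of_nonneg (norm_nonneg _) two_ne_zero).1 h2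

theorem mobius_mem_ball (ha : a ∈ Metric.ball (0 : EuclideanSpace ℝ (Fin n)) 1)
    (hx : x ∈ Metric.ball (0 : EuclideanSpace ℝ (Fin n)) 1) :
    mobius a x ∈ Metric.ball (0 : EuclideanSpace ℝ (Fin n)) 1 := by
  have hx1 : ‖x‖ ≤ 1 := (mem_ball_zero_iff.1 hx).le
  have h := norm_mobius_sq ha hx1
  have h1 := one_sub_norm_sq_pos ha
  have h2 := one_sub_norm_sq_pos hx
  have h3 := bracket_pos ha hx1
  have h4 : 0 < 1 - ‖mobius a x‖ ^ 2 := by rw [h]; positivity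
  rw [mem_ball_zero_iff]
  nlinarith [norm_nonneg (mobius a x)]

/-- With t = (1 - |a|²)/|a - ξ|², the point a + t(a - ξ) differs from a by a vector of squared
length t²|a - ξ|², so the second application has coefficient 1/t and undoes the first. -/
theorem mobius_mobius_of_norm_eq_one (ha : a ∈ Metric.ball (0 : EuclideanSpace ℝ (Fin n)) 1)
    (hξ : ‖ξ‖ = 1) : mobius a (mobius a ξ) = ξ := by
  have hN := norm_sub_pos ha hξ
  have h1 := one_sub_norm_sq_pos ha
  rw [mobius_of_norm_eq_one ha (norm_mobius_of_norm_eq_one ha hξ), mobius_of_norm_eq_one ha hξ,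
    sub_add_cancel_left, norm_neg, norm_smul, smul_neg, smul_smul, mul_pow, Real.norm_eq_abs,
    sq_abs]
  have : (1 - ‖a‖ ^ 2) / (((1 - ‖a‖ ^ 2) / ‖a - ξ‖ ^ 2) ^ 2 * ‖a - ξ‖ ^ 2) *
      ((1 - ‖a‖ ^ 2) / ‖a - ξ‖ ^ 2) = 1 := by
    field_simp
  rw [this]
  module

theorem bracket_mobius (ha : a ∈ Metric.ball (0 : EuclideanSpace ℝ (Fin n)) 1)
    (hx : x ∈ Metric.ball (0 : EuclideanSpace ℝ (Fin n)) 1) :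
    bracket (mobius a x) a = (1 - ‖a‖ ^ 2) / bracket x a := by
  have hx1 : ‖x‖ ≤ 1 := (mem_ball_zero_iff.1 hx).le
  have hm1 : ‖mobius a x‖ ≤ 1 := (mem_ball_zero_iff.1 (mobius_mem_ball ha hx)).le
  have hB := (bracket_sq_pos ha hx1).ne'
  have hb := bracket_pos ha hx1
  have h1 := one_sub_norm_sq_pos ha
  refine (pow_left_inj₀ (bracket_pos ha hm1).le (by positivity) two_ne_zero).1 ?_
  have h2 : ‖mobius a x‖ ^ 2 = 1 - (1 - ‖a‖ ^ 2) * (1 - ‖x‖ ^ 2) / bracket x a ^ 2 := by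
    linarith [norm_mobius_sq ha hx1]
  have h3 : inner ℝ a (mobius a x) = (1 + ‖a‖ ^ 2 * ‖x‖ ^ 2 - 2 * inner ℝ a x)⁻¹ *
      ((1 - 2 * inner ℝ a x + ‖x‖ ^ 2) * ‖a‖ ^ 2 - (1 - ‖a‖ ^ 2) * inner ℝ a x) := by
    rw [mobius_eq_smul_sub_smul ha hx1, real_inner_smul_right, inner_sub_right,
      real_inner_smul_right, real_inner_smul_right, real_inner_self_eq_norm_sq]
  rw [bracket_sq ha hm1, div_pow, h2, h3, bracket_sq ha hx1]
  field_simp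
  ring

theorem norm_mobius_sub_mobius (ha : a ∈ Metric.ball (0 : EuclideanSpace ℝ (Fin n)) 1)
    (hx : x ∈ Metric.ball (0 : EuclideanSpace ℝ (Fin n)) 1) (hξ : ‖ξ‖ = 1) :
    ‖mobius a x - mobius a ξ‖ =
      (1 - ‖a‖ ^ 2) * ‖x - ξ‖ / (bracket x a * ‖a - ξ‖) := by
  have hx1 : ‖x‖ ≤ 1 := (mem_ball_zero_iff.1 hx).le
  have hB := (bracket_sq_pos ha hx1).ne'
  have hb := bracket_pos ha hx1
  have hN := norm_sub_pos ha hξ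
  have h1 := one_sub_norm_sq_pos ha
  refine (pow_left_inj₀ (norm_nonneg _) (by positivity) two_ne_zero).1 ?_
  have h2 : ‖mobius a x‖ ^ 2 = 1 - (1 - ‖a‖ ^ 2) * (1 - ‖x‖ ^ 2) / bracket x a ^ 2 := by
    linarith [norm_mobius_sq ha hx1]
  have hN2 : ‖a - ξ‖ ^ 2 = ‖a‖ ^ 2 - 2 * inner ℝ a ξ + 1 := by
    rw [norm_sub_sq_real, hξ]; ring
  have hD : ‖a‖ ^ 2 - 2 * inner ℝ a ξ + 1 ≠ 0 := by rw [← hN2]; positivity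
  have h3 : inner ℝ (mobius a x) (mobius a ξ) =
      (1 + ‖a‖ ^ 2 * ‖x‖ ^ 2 - 2 * inner ℝ a x)⁻¹ *
      ((1 - 2 * inner ℝ a x + ‖x‖ ^ 2) * (‖a‖ ^ 2 + (1 - ‖a‖ ^ 2) /
        (‖a‖ ^ 2 - 2 * inner ℝ a ξ + 1) * (‖a‖ ^ 2 - inner ℝ a ξ)) -
      (1 - ‖a‖ ^ 2) * (inner ℝ a x + (1 - ‖a‖ ^ 2) /
        (‖a‖ ^ 2 - 2 * inner ℝ a ξ + 1) * (inner ℝ a x - inner ℝ x ξ))) := by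
    rw [mobius_eq_smul_sub_smul ha hx1, mobius_of_norm_eq_one ha hξ, real_inner_smul_left,
      inner_sub_left, real_inner_smul_left, real_inner_smul_left, inner_add_right, inner_add_right,
      real_inner_smul_right, real_inner_smul_right, inner_sub_right, inner_sub_right,
      real_inner_self_eq_norm_sq, hN2, real_inner_comm a x]
  rw [norm_sub_sq_real, norm_mobius_of_norm_eq_one ha hξ, h2, h3, div_pow, mul_pow, mul_pow, hN2,
    bracket_sq ha hx1, norm_sub_sq_real x ξ, hξ]
  field_simp
  ring

/-- The Clifford norm is [φ_a(x), a] = (1 - |a|²)/[x, a]. The powers of [x, a] then cancel, with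
exponents -(n - 2), -2 and n, and those of 1 - |a|² add up to (n - 2) + 1 - n = -1. The exponent n -
2 is a truncated subtraction, harmless because n ≥ 2. -/
theorem extremal_mobius (hn : 2 ≤ n) (ha : a ∈ Metric.ball (0 : EuclideanSpace ℝ (Fin n)) 1)
    (hx : x ∈ Metric.ball (0 : EuclideanSpace ℝ (Fin n)) 1) (hξ : ‖ξ‖ = 1) :
    extremal a (mobius a ξ) x = poisson ξ x / poisson ξ a := by
  have hx1 : ‖x‖ ≤ 1 := (mem_ball_zero_iff.1 hx).le
  have hb := bracket_pos ha hx1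
  have hN := norm_sub_pos ha hξ
  have hN' := norm_sub_pos hx hξ
  have h1 := one_sub_norm_sq_pos ha
  rw [extremal, clNorm_one_sub_para_mul_star (by omega), bracket_mobius ha hx, poisson,
    norm_mobius_sq ha hx1, norm_mobius_sub_mobius ha hx hξ, poisson, poisson]
  generalize 1 - ‖a‖ ^ 2 = β at *
  obtain ⟨k, rfl⟩ : ∃ k, n = k + 2 := ⟨n - 2, by omega⟩
  rw [Nat.add_sub_cancel]
  simp only [div_pow, mul_pow]
  field_simp
  ring

/-- With P = P_ξ(a) and t = (1 - |a|²)/|a - ξ|², the gradient term is 2P a + nP t (a - ξ). Adding (n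
- 2)P a completes it to nP (a + t(a - ξ)); this is where the coefficient n - 2 in (1) comes from. -/
theorem smul_poissonGrad_add_smul (ha : a ∈ Metric.ball (0 : EuclideanSpace ℝ (Fin n)) 1)
    (hξ : ‖ξ‖ = 1) :
    (‖a‖ ^ 2 - 1) • poissonGrad ξ a + (((n : ℝ) - 2) * poisson ξ a) • a =
      (n * poisson ξ a) • mobius a ξ := by
  have hN := norm_sub_pos ha hξ
  rw [mobius_of_norm_eq_one ha hξ, poissonGrad, poisson]
  generalize a - ξ = y at *
  match_scalars <;> field_simp <;> ring

theorem continuous_mobius_sphere (ha : a ∈ Metric.ball (0 : EuclideanSpace ℝ (Fin n)) 1) :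
    Continuous fun ξ : Metric.sphere (0 : EuclideanSpace ℝ (Fin n)) 1 =>
      mobius a (ξ : EuclideanSpace ℝ (Fin n)) := by
  have h : Continuous fun ξ : Metric.sphere (0 : EuclideanSpace ℝ (Fin n)) 1 =>
      (bracket (ξ : EuclideanSpace ℝ (Fin n)) a ^ 2)⁻¹ :=
    Continuous.inv₀ (by unfold bracket; fun_prop) fun ξ =>
      (pow_pos (bracket_pos ha (norm_eq_of_mem_sphere ξ).le) 2).ne'
  unfold mobius
  fun_prop

theorem continuous_extremal_sphere (ha : a ∈ Metric.ball (0 : EuclideanSpace ℝ (Fin n)) 1)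
    (hx : x ∈ Metric.ball (0 : EuclideanSpace ℝ (Fin n)) 1) :
    Continuous fun ζ : Metric.sphere (0 : EuclideanSpace ℝ (Fin n)) 1 =>
      extremal a (ζ : EuclideanSpace ℝ (Fin n)) x := by
  unfold extremal
  exact continuous_const.mul (continuous_poisson_sphere (mobius_mem_ball ha hx))

end Mobius

/-! ### The gradient estimate, its equality case and the converse -/

section Main

open MeasureTheory

variable {n : ℕ} {f : EuclideanSpace ℝ (Fin n) → ℝ} {a x : EuclideanSpace ℝ (Fin n)} {r : ℝ}

theorem smul_mem_ball (h0 : 0 ≤ r) (h1 : r < 1) (hx : ‖x‖ ≤ 1) :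
    r • x ∈ Metric.ball (0 : EuclideanSpace ℝ (Fin n)) 1 := by
  rw [mem_ball_zero_iff, norm_smul, Real.norm_of_nonneg h0]
  nlinarith [norm_nonneg x]

theorem continuous_comp_smul_sphere
    (hf : InnerProductSpace.HarmonicOnNhd f (Metric.ball 0 1)) (h0 : 0 ≤ r) (h1 : r < 1) :
    Continuous fun ξ : Metric.sphere (0 : EuclideanSpace ℝ (Fin n)) 1 =>
      f (r • (ξ : EuclideanSpace ℝ (Fin n))) := by
  rw [← continuousOn_univ]
  exact hf.continuousOn.comp (by fun_prop)
    fun ξ _ => smul_mem_ball h0 h1 (norm_eq_of_mem_sphere ξ).le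

/-- f need not have boundary values, but for r < 1 its dilate is continuous on the closed ball. -/
theorem poissonIntegral_comp_smul [NeZero n]
    (hf : InnerProductSpace.HarmonicOnNhd f (Metric.ball 0 1)) (h0 : 0 ≤ r) (h1 : r < 1)
    (hx : x ∈ Metric.ball (0 : EuclideanSpace ℝ (Fin n)) 1) :
    poissonIntegral (fun ξ => f (r • (ξ : EuclideanSpace ℝ (Fin n)))) x =
      (sphereMeasure n).real Set.univ * f (r • x) := by
  refine poissonIntegral_eq (f := fun x => f (r • x))
    ((isDirHarmonic_of_harmonicOnNhd hf).comp_smul h0 h1.le) ?_ hx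
  exact hf.continuousOn.comp (by fun_prop)
    fun y hy => smul_mem_ball h0 h1 (by simpa using hy)

/-- Both sides are derivatives at a of the Poisson formula for the dilate, in the direction v; the
factor r comes from the chain rule. -/
theorem integral_inner_poissonGrad [NeZero n]
    (hf : InnerProductSpace.HarmonicOnNhd f (Metric.ball 0 1)) (h0 : 0 ≤ r) (h1 : r < 1)
    (ha : a ∈ Metric.ball (0 : EuclideanSpace ℝ (Fin n)) 1) (v : EuclideanSpace ℝ (Fin n)) :
    ∫ ξ : Metric.sphere (0 : EuclideanSpace ℝ (Fin n)) 1, f (r • (ξ : EuclideanSpace ℝ (Fin n))) *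
        innerSL ℝ (poissonGrad (ξ : EuclideanSpace ℝ (Fin n)) a) v ∂(sphereMeasure n) =
      (sphereMeasure n).real Set.univ * (r * fderiv ℝ f (r • a) v) := by
  have hc := continuous_comp_smul_sphere hf h0 h1
  have hra := smul_mem_ball h0 h1 (mem_ball_zero_iff.1 ha).le
  rw [← integral_smul_innerSL_poissonGrad_apply hc ha]
  have e1 := hasFDerivAt_poissonIntegral hc ha
  have e2 : HasFDerivAt (fun x => (sphereMeasure n).real Set.univ * f (r • x))
      ((sphereMeasure n).real Set.univ • (fderiv ℝ f (r • a)).comp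
        (r • ContinuousLinearMap.id ℝ (EuclideanSpace ℝ (Fin n)))) a :=
    (((hf _ hra).1.differentiableAt (by norm_num)).hasFDerivAt.comp a
      ((hasFDerivAt_id a).const_smul r)).const_mul _
  have e3 : (fun x => (sphereMeasure n).real Set.univ * f (r • x)) =ᶠ[nhds a]
      poissonIntegral (fun ξ => f (r • (ξ : EuclideanSpace ℝ (Fin n)))) := by
    filter_upwards [Metric.isOpen_ball.mem_nhds ha] with y hy
    exact (poissonIntegral_comp_smul hf h0 h1 hy).symm
  rw [e1.unique (e2.congr_of_eventuallyEq e3.symm)]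
  simp

/-- The integral representation of the left side of the gradient estimate. -/
theorem integral_inner_mobius [NeZero n]
    (hf : InnerProductSpace.HarmonicOnNhd f (Metric.ball 0 1)) (h0 : 0 ≤ r) (h1 : r < 1)
    (ha : a ∈ Metric.ball (0 : EuclideanSpace ℝ (Fin n)) 1) (v : EuclideanSpace ℝ (Fin n)) :
    n * ∫ ξ : Metric.sphere (0 : EuclideanSpace ℝ (Fin n)) 1,
        f (r • (ξ : EuclideanSpace ℝ (Fin n))) * poisson (ξ : EuclideanSpace ℝ (Fin n)) a *
          inner ℝ (mobius a (ξ : EuclideanSpace ℝ (Fin n))) v ∂(sphereMeasure n) =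
      (sphereMeasure n).real Set.univ * ((‖a‖ ^ 2 - 1) * (r * fderiv ℝ f (r • a) v) +
        (((n : ℝ) - 2) * f (r • a)) * inner ℝ a v) := by
  have hc := continuous_comp_smul_sphere hf h0 h1
  have hg : Continuous fun ξ : Metric.sphere (0 : EuclideanSpace ℝ (Fin n)) 1 =>
      poissonGrad (ξ : EuclideanSpace ℝ (Fin n)) a := by
    rw [← continuousOn_univ]
    exact continuousOn_poissonGrad.comp (f := fun ξ => (a, ξ)) (by fun_prop)
      fun ξ _ => ⟨ha, trivial⟩
  have hP := continuous_poisson_sphere ha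
  have e1 := integral_inner_poissonGrad hf h0 h1 ha v
  have e2 := poissonIntegral_comp_smul hf h0 h1 ha
  rw [poissonIntegral] at e2
  simp only [innerSL_apply_apply] at e1
  have e3 : (sphereMeasure n).real Set.univ * ((‖a‖ ^ 2 - 1) * (r * fderiv ℝ f (r • a) v) +
        (((n : ℝ) - 2) * f (r • a)) * inner ℝ a v) =
      (‖a‖ ^ 2 - 1) * ((sphereMeasure n).real Set.univ * (r * fderiv ℝ f (r • a) v)) +
        (((n : ℝ) - 2) * inner ℝ a v) * ((sphereMeasure n).real Set.univ * f (r • a)) := by ring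
  rw [e3, ← e1, ← e2, ← integral_const_mul, ← integral_const_mul, ← integral_const_mul,
    ← integral_add (integrable_sphereMeasure
      (continuous_const.fun_mul (hc.fun_mul (hg.inner continuous_const))))
      (integrable_sphereMeasure (continuous_const.fun_mul (hc.fun_mul hP)))]
  refine integral_congr_ae (Filter.Eventually.of_forall fun ξ => ?_)
  have h := congrArg (fun w => f (r • (ξ : EuclideanSpace ℝ (Fin n))) * inner ℝ w v)
    (smul_poissonGrad_add_smul ha (norm_eq_of_mem_sphere ξ))
  simp only [inner_add_left, real_inner_smul_left] at h
  linarith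

theorem tendsto_comp_smul (hf : InnerProductSpace.HarmonicOnNhd f (Metric.ball 0 1))
    (ha : a ∈ Metric.ball (0 : EuclideanSpace ℝ (Fin n)) 1) :
    Filter.Tendsto (fun r : ℝ => f (r • a)) (nhdsWithin 1 (Set.Iio 1)) (nhds (f a)) := by
  have h1 : Filter.Tendsto (fun r : ℝ => r • a) (nhds 1) (nhds a) := by
    simpa using (Continuous.tendsto (by fun_prop : Continuous fun r : ℝ => r • a) 1)
  exact ((hf a ha).1.continuousAt.tendsto.comp h1).mono_left nhdsWithin_le_nhds

theorem tendsto_deriv_comp_smul (hf : InnerProductSpace.HarmonicOnNhd f (Metric.ball 0 1))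
    (ha : a ∈ Metric.ball (0 : EuclideanSpace ℝ (Fin n)) 1) (v : EuclideanSpace ℝ (Fin n)) :
    Filter.Tendsto (fun r : ℝ => (‖a‖ ^ 2 - 1) * (r * fderiv ℝ f (r • a) v) +
        (((n : ℝ) - 2) * f (r • a)) * inner ℝ a v) (nhdsWithin 1 (Set.Iio 1))
      (nhds (inner ℝ ((‖a‖ ^ 2 - 1) • ∇ f a + (((n : ℝ) - 2) * f a) • a) v)) := by
  have h1 : Filter.Tendsto (fun r : ℝ => r • a) (nhds 1) (nhds a) := by
    simpa using (Continuous.tendsto (by fun_prop : Continuous fun r : ℝ => r • a) 1)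
  have h2 : ContinuousAt (fun y => fderiv ℝ f y v) a :=
    (((hf a ha).1.fderiv_right (m := 1) (by norm_num)).continuousAt).clm_apply continuousAt_const
  have h3 : Filter.Tendsto (fun r : ℝ => fderiv ℝ f (r • a) v) (nhdsWithin 1 (Set.Iio 1))
      (nhds (fderiv ℝ f a v)) := (h2.tendsto.comp h1).mono_left nhdsWithin_le_nhds
  have h4 : Filter.Tendsto (fun r : ℝ => r) (nhdsWithin 1 (Set.Iio 1)) (nhds 1) :=
    nhdsWithin_le_nhds
  have h5 := ((h4.mul h3).const_mul (‖a‖ ^ 2 - 1)).add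
    (((tendsto_comp_smul hf ha).const_mul ((n : ℝ) - 2)).mul_const (inner ℝ a v))
  have h6 : inner ℝ (∇ f a) v = fderiv ℝ f a v := by
    rw [gradient, InnerProductSpace.toDual_symm_apply]
  rw [inner_add_left, real_inner_smul_left, real_inner_smul_left, h6]
  simpa using h5

theorem eventually_nonneg_lt_one : ∀ᶠ r : ℝ in nhdsWithin 1 (Set.Iio 1), 0 ≤ r ∧ r < 1 :=
  ((eventually_ge_nhds zero_lt_one).filter_mono nhdsWithin_le_nhds).and self_mem_nhdsWithin

/-- Cauchy–Schwarz bounds ⟨φ_a(ξ), v⟩ by |v| under the positive weight f(rξ) P_ξ(a), whose total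
mass is f(ra) times the area of the sphere; then r → 1. -/
theorem inner_gradient_le [NeZero n] (hf : InnerProductSpace.HarmonicOnNhd f (Metric.ball 0 1))
    (hpos : ∀ x ∈ Metric.ball (0 : EuclideanSpace ℝ (Fin n)) 1, 0 < f x)
    (ha : a ∈ Metric.ball (0 : EuclideanSpace ℝ (Fin n)) 1) (v : EuclideanSpace ℝ (Fin n)) :
    inner ℝ ((‖a‖ ^ 2 - 1) • ∇ f a + (((n : ℝ) - 2) * f a) • a) v ≤ n * f a * ‖v‖ := by
  refine le_of_tendsto_of_tendsto (tendsto_deriv_comp_smul hf ha v)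
    (((tendsto_comp_smul hf ha).const_mul (n : ℝ)).mul_const ‖v‖) ?_
  filter_upwards [eventually_nonneg_lt_one] with r ⟨h0, h1⟩
  have hc0 : 0 < (sphereMeasure n).real Set.univ := sphereMeasure_real_univ_pos
  refine le_of_mul_le_mul_left ?_ hc0
  have hc := continuous_comp_smul_sphere hf h0 h1
  have hP := continuous_poisson_sphere ha
  have hm := continuous_mobius_sphere ha
  have e2 := poissonIntegral_comp_smul hf h0 h1 ha
  rw [poissonIntegral] at e2
  rw [← integral_inner_mobius hf h0 h1 ha v]
  calc _ ≤ n * ∫ ξ : Metric.sphere (0 : EuclideanSpace ℝ (Fin n)) 1,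
        f (r • (ξ : EuclideanSpace ℝ (Fin n))) * poisson (ξ : EuclideanSpace ℝ (Fin n)) a *
          ‖v‖ ∂(sphereMeasure n) := by
        refine mul_le_mul_of_nonneg_left (integral_mono
          (integrable_sphereMeasure ((hc.mul hP).mul (hm.inner continuous_const)))
          (integrable_sphereMeasure ((hc.mul hP).mul continuous_const)) fun ξ => ?_) (Nat.cast_nonneg n)
        have hξ := norm_eq_of_mem_sphere ξ
        have h2 := real_inner_le_norm (mobius a (ξ : EuclideanSpace ℝ (Fin n))) v
        rw [norm_mobius_of_norm_eq_one ha hξ, one_mul] at h2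
        exact mul_le_mul_of_nonneg_left h2
          (mul_pos (hpos _ (smul_mem_ball h0 h1 hξ.le)) (poisson_pos ha hξ)).le
    _ = _ := by
        rw [integral_mul_const, e2]
        ring

theorem norm_gradient_le [NeZero n] (hf : InnerProductSpace.HarmonicOnNhd f (Metric.ball 0 1))
    (hpos : ∀ x ∈ Metric.ball (0 : EuclideanSpace ℝ (Fin n)) 1, 0 < f x)
    (ha : a ∈ Metric.ball (0 : EuclideanSpace ℝ (Fin n)) 1) :
    ‖(‖a‖ ^ 2 - 1) • ∇ f a + (((n : ℝ) - 2) * f a) • a‖ ≤ n * f a := by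
  have h := inner_gradient_le hf hpos ha ((‖a‖ ^ 2 - 1) • ∇ f a + (((n : ℝ) - 2) * f a) • a)
  rw [real_inner_self_eq_norm_sq] at h
  have h0 : 0 ≤ n * f a := mul_nonneg (Nat.cast_nonneg n) (hpos a ha).le
  nlinarith [norm_nonneg ((‖a‖ ^ 2 - 1) • ∇ f a + (((n : ℝ) - 2) * f a) • a)]

/-- A Chebyshev-type bound: continuity handles points near v, and boundedness of G the points at
distance at least δ. It turns a vanishing second moment about v into convergence of averages of G.
-/
theorem exists_abs_sub_le_add_mul_dist_sq {K : Type*} [PseudoMetricSpace K] [CompactSpace K]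
    {G : K → ℝ} (hG : Continuous G) (v : K) {ε : ℝ} (hε : 0 < ε) :
    ∃ C, ∀ ζ, |G ζ - G v| ≤ ε + C * dist ζ v ^ 2 := by
  obtain ⟨δ, hδ, h⟩ := Metric.continuous_iff.1 hG v ε hε
  obtain ⟨M, hM⟩ := isCompact_univ.exists_bound_of_continuousOn hG.continuousOn
  have hM0 : 0 ≤ M := (norm_nonneg _).trans (hM v trivial)
  refine ⟨2 * M / δ ^ 2, fun ζ => ?_⟩
  rcases lt_or_ge (dist ζ v) δ with hd | hd
  · have h1 := h ζ hd
    rw [Real.dist_eq] at h1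
    have : 0 ≤ 2 * M / δ ^ 2 * dist ζ v ^ 2 := by positivity
    linarith
  · have h1 : |G ζ - G v| ≤ 2 * M := by
      have := norm_sub_le (G ζ) (G v)
      rw [Real.norm_eq_abs] at this
      linarith [hM ζ trivial, hM v trivial]
    have h2 : 2 * M ≤ 2 * M / δ ^ 2 * dist ζ v ^ 2 := by
      rw [div_mul_eq_mul_div, le_div_iff₀ (by positivity)]
      gcongr
    linarith

/-- The boundary point is the unit vector in the direction of the left side of (1): equality makes
the weights f(rξ) P_ξ(a) concentrate, as r → 1, where φ_a(ξ) is close to it. -/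
theorem eq_extremal_of_norm_gradient_eq (hn : 2 ≤ n)
    (hf : InnerProductSpace.HarmonicOnNhd f (Metric.ball 0 1))
    (hpos : ∀ x ∈ Metric.ball (0 : EuclideanSpace ℝ (Fin n)) 1, 0 < f x)
    (ha : a ∈ Metric.ball (0 : EuclideanSpace ℝ (Fin n)) 1)
    (heq : ‖(‖a‖ ^ 2 - 1) • ∇ f a + (((n : ℝ) - 2) * f a) • a‖ = n * f a) :
    ∃ ξ ∈ Metric.sphere (0 : EuclideanSpace ℝ (Fin n)) 1,
      ∀ x ∈ Metric.ball (0 : EuclideanSpace ℝ (Fin n)) 1, f x = f a * extremal a ξ x := by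
  have : NeZero n := ⟨by omega⟩
  have hfa := hpos a ha
  have hn0 : (0 : ℝ) < n := by exact_mod_cast NeZero.pos n
  set V := (‖a‖ ^ 2 - 1) • ∇ f a + (((n : ℝ) - 2) * f a) • a with hV
  set v := (n * f a)⁻¹ • V with hv
  have hv1 : ‖v‖ = 1 := by
    rw [hv, norm_smul, heq, Real.norm_of_nonneg (by positivity)]
    field_simp
  have hVv : inner ℝ V v = n * f a := by
    rw [hv, real_inner_smul_right, real_inner_self_eq_norm_sq, heq]
    field_simp
  refine ⟨v, by simpa using hv1, fun x hx => ?_⟩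
  set c := (sphereMeasure n).real Set.univ
  have hc0 : 0 < c := sphereMeasure_real_univ_pos
  let vs : Metric.sphere (0 : EuclideanSpace ℝ (Fin n)) 1 := ⟨v, by simpa using hv1⟩
  have key : ∀ ε > 0, |c * f x - c * f a * extremal a v x| ≤ ε * (c * f a) := by
    intro ε hε
    -- C depends on ε but not on r, so it is fixed while r → 1.
    obtain ⟨C, hC⟩ := exists_abs_sub_le_add_mul_dist_sq (continuous_extremal_sphere ha hx) vs hε
    let Vr : ℝ → ℝ := fun r => (‖a‖ ^ 2 - 1) * (r * fderiv ℝ f (r • a) v) +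
      (((n : ℝ) - 2) * f (r • a)) * inner ℝ a v
    have hlimV : Filter.Tendsto Vr (nhdsWithin 1 (Set.Iio 1)) (nhds (n * f a)) := by
      have := tendsto_deriv_comp_smul hf ha v
      rwa [← hV, hVv] at this
    have hlimL : Filter.Tendsto (fun r : ℝ => |c * f (r • x) - c * f (r • a) * extremal a v x|)
        (nhdsWithin 1 (Set.Iio 1)) (nhds |c * f x - c * f a * extremal a v x|) :=
      (((tendsto_comp_smul hf hx).const_mul c).sub
        (((tendsto_comp_smul hf ha).const_mul c).mul_const _)).abs
    -- The factor after C is the weighted integral of |φ_a(ξ) - v|² = 2 - 2⟨φ_a(ξ), v⟩. It tends to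
    -- 2c f(a) - (2/n) c n f(a) = 0, and this is the only place where equality in (1) acts.
    have hlimR : Filter.Tendsto (fun r : ℝ => ε * (c * f (r • a)) +
        C * (2 * (c * f (r • a)) - 2 / n * (c * Vr r)))
        (nhdsWithin 1 (Set.Iio 1)) (nhds (ε * (c * f a))) := by
      have h1 := (((tendsto_comp_smul hf ha).const_mul c).const_mul ε).add
        (((((tendsto_comp_smul hf ha).const_mul c).const_mul 2).sub
          ((hlimV.const_mul c).const_mul (2 / (n : ℝ)))).const_mul C)
      convert h1 using 2
      field_simp
      ring
    refine le_of_tendsto_of_tendsto hlimL hlimR ?_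
    filter_upwards [eventually_nonneg_lt_one] with r ⟨h0, h1⟩
    have hc := continuous_comp_smul_sphere hf h0 h1
    have hP := continuous_poisson_sphere ha
    have hPx := continuous_poisson_sphere hx
    have hm := continuous_mobius_sphere ha
    have e1 := poissonIntegral_comp_smul hf h0 h1 ha
    have e2 := poissonIntegral_comp_smul hf h0 h1 hx
    have e3 := integral_inner_mobius hf h0 h1 ha v
    rw [poissonIntegral] at e1 e2
    have e4 : c * Vr r / n = ∫ ξ : Metric.sphere (0 : EuclideanSpace ℝ (Fin n)) 1,
        f (r • (ξ : EuclideanSpace ℝ (Fin n))) * poisson (ξ : EuclideanSpace ℝ (Fin n)) a *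
          inner ℝ (mobius a (ξ : EuclideanSpace ℝ (Fin n))) v ∂(sphereMeasure n) := by
      rw [div_eq_iff hn0.ne', mul_comm _ (n : ℝ)]
      exact e3.symm
    have e5 : ε * (c * f (r • a)) + C * (2 * (c * f (r • a)) - 2 / n * (c * Vr r)) =
        (ε + 2 * C) * (c * f (r • a)) - 2 * C * (c * Vr r / n) := by ring
    have e6 : c * f (r • x) - c * f (r • a) * extremal a v x =
        c * f (r • x) - extremal a v x * (c * f (r • a)) := by ring
    rw [e5, e6, e4, ← e1, ← e2, ← integral_const_mul, ← integral_const_mul, ← integral_const_mul]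
    have c1 := hc.fun_mul hPx
    have c2 := (continuous_const (y := extremal a v x)).fun_mul (hc.fun_mul hP)
    have c3 := (continuous_const (y := ε + 2 * C)).fun_mul (hc.fun_mul hP)
    have c4 := (continuous_const (y := 2 * C)).fun_mul
      ((hc.fun_mul hP).fun_mul (hm.inner (continuous_const (y := v))))
    rw [← integral_sub (integrable_sphereMeasure c1) (integrable_sphereMeasure c2),
      ← integral_sub (integrable_sphereMeasure c3) (integrable_sphereMeasure c4),
      ← Real.norm_eq_abs]
    refine norm_integral_le_of_norm_le (integrable_sphereMeasure (c3.sub c4))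
      (Filter.Eventually.of_forall fun ξ => ?_)
    have hξ := norm_eq_of_mem_sphere ξ
    have hPa := poisson_pos ha hξ
    have hfr := hpos _ (smul_mem_ball h0 h1 hξ.le)
    have hw := hC ⟨mobius a ξ, by simpa using norm_mobius_of_norm_eq_one ha hξ⟩
    rw [Subtype.dist_eq, dist_eq_norm] at hw
    simp only [vs] at hw
    rw [norm_sub_sq_real, norm_mobius_of_norm_eq_one ha hξ, hv1] at hw
    -- This rewrites the Poisson integral at x as an average, against the weights at a, of a
    -- continuous function of φ_a(ξ), to which the bound `hw` applies.
    have hext : poisson (ξ : EuclideanSpace ℝ (Fin n)) x =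
        poisson (ξ : EuclideanSpace ℝ (Fin n)) a *
          extremal a (mobius a (ξ : EuclideanSpace ℝ (Fin n))) x := by
      rw [extremal_mobius hn ha hx hξ]
      field_simp
    have hfac : f (r • (ξ : EuclideanSpace ℝ (Fin n))) *
        poisson (ξ : EuclideanSpace ℝ (Fin n)) x - extremal a v x *
        (f (r • (ξ : EuclideanSpace ℝ (Fin n))) * poisson (ξ : EuclideanSpace ℝ (Fin n)) a) =
        f (r • (ξ : EuclideanSpace ℝ (Fin n))) * poisson (ξ : EuclideanSpace ℝ (Fin n)) a *
        (extremal a (mobius a (ξ : EuclideanSpace ℝ (Fin n))) x - extremal a v x) := by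
      rw [hext]; ring
    rw [hfac, norm_mul, Real.norm_of_nonneg (mul_pos hfr hPa).le, Real.norm_eq_abs]
    calc _ ≤ _ := mul_le_mul_of_nonneg_left hw (mul_pos hfr hPa).le
      _ = _ := by ring
  have h0 : |c * f x - c * f a * extremal a v x| ≤ 0 := by
    refine le_of_forall_pos_le_add fun ε hε => ?_
    have := key (ε / (c * f a)) (by positivity)
    rwa [div_mul_cancel₀ _ (by positivity), ← zero_add ε] at this
  have h1 := abs_nonpos_iff.1 h0
  refine mul_left_cancel₀ hc0.ne' ?_
  linarith

/-- With η = φ_a(ξ) we have φ_a(η) = ξ, so f is a positive multiple of P_η on the ball. The gradient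
identity for P_η holds at each x, with the unit vector φ_x(η), which gives equality everywhere. -/
theorem harmonic_and_norm_gradient_eq_of_eq_extremal (hn : 2 ≤ n)
    (ha : a ∈ Metric.ball (0 : EuclideanSpace ℝ (Fin n)) 1) {ξ : EuclideanSpace ℝ (Fin n)}
    (hξ : ‖ξ‖ = 1) (hfa : 0 < f a)
    (hf : ∀ x ∈ Metric.ball (0 : EuclideanSpace ℝ (Fin n)) 1, f x = f a * extremal a ξ x) :
    InnerProductSpace.HarmonicOnNhd f (Metric.ball 0 1) ∧
      ∀ x ∈ Metric.ball (0 : EuclideanSpace ℝ (Fin n)) 1,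
        0 < f x ∧ ‖(‖x‖ ^ 2 - 1) • ∇ f x + (((n : ℝ) - 2) * f x) • x‖ = n * f x := by
  have hη := norm_mobius_of_norm_eq_one ha hξ
  set η := mobius a ξ with hηdef
  set k := f a / poisson η a with hk
  have hk0 : 0 < k := div_pos hfa (poisson_pos ha hη)
  have hfk : ∀ x ∈ Metric.ball (0 : EuclideanSpace ℝ (Fin n)) 1, f x = k * poisson η x := by
    intro x hx
    have h := extremal_mobius hn ha hx hη
    rw [hηdef, mobius_mobius_of_norm_eq_one ha hξ, ← hηdef] at h
    rw [hf x hx, h, hk]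
    ring
  -- f is arbitrary outside the ball; harmonicity and the gradient at x depend only on the germ of
  -- f.
  have hev : ∀ x ∈ Metric.ball (0 : EuclideanSpace ℝ (Fin n)) 1,
      f =ᶠ[nhds x] k • poisson η := by
    intro x hx
    filter_upwards [Metric.isOpen_ball.mem_nhds hx] with y hy using hfk y hy
  refine ⟨fun x hx => (InnerProductSpace.harmonicAt_congr_nhds (hev x hx)).2
    ((harmonicOnNhd_poisson hη x hx).const_smul), fun x hx => ?_⟩
  have hP := poisson_pos hx hη
  have hgrad : ∇ f x = k • poissonGrad η x := by
    refine HasGradientAt.gradient ?_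
    rw [hasGradientAt_iff_hasFDerivAt]
    have h1 := (hasFDerivAt_poisson (ne_of_mem_ball_of_mem_sphere hx hη)).const_smul k
    refine (h1.congr_fderiv ?_).congr_of_eventuallyEq (hev x hx)
    ext v
    simp
  refine ⟨by rw [hfk x hx]; positivity, ?_⟩
  have h2 : (‖x‖ ^ 2 - 1) • ∇ f x + (((n : ℝ) - 2) * f x) • x =
      k • ((n * poisson η x) • mobius x η) := by
    rw [← smul_poissonGrad_add_smul hx hη, hgrad, hfk x hx]
    module
  rw [h2, norm_smul, norm_smul, norm_mobius_of_norm_eq_one hx hη,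
    Real.norm_of_nonneg hk0.le, Real.norm_of_nonneg (by positivity), hfk x hx]
  ring

end Main

end BallHarmonic

theorem mainTheorem2 (n : ℕ) (hn : 2 ≤ n) :
    (∀ f : EuclideanSpace ℝ (Fin n) → ℝ,
      InnerProductSpace.HarmonicOnNhd f (Metric.ball 0 1) →
      (∀ x ∈ Metric.ball (0 : EuclideanSpace ℝ (Fin n)) 1, 0 < f x) →
      (∀ x ∈ Metric.ball (0 : EuclideanSpace ℝ (Fin n)) 1,
        ‖(‖x‖ ^ 2 - 1) • ∇ f x + (((n : ℝ) - 2) * f x) • x‖ ≤ n * f x) ∧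
      (∀ a ∈ Metric.ball (0 : EuclideanSpace ℝ (Fin n)) 1,
        ‖(‖a‖ ^ 2 - 1) • ∇ f a + (((n : ℝ) - 2) * f a) • a‖ = n * f a →
        ∃ ξ ∈ Metric.sphere (0 : EuclideanSpace ℝ (Fin n)) 1,
          ∀ x ∈ Metric.ball (0 : EuclideanSpace ℝ (Fin n)) 1,
            f x = f a * BallHarmonic.extremal a ξ x)) ∧
    (∀ a ∈ Metric.ball (0 : EuclideanSpace ℝ (Fin n)) 1,
      ∀ ξ ∈ Metric.sphere (0 : EuclideanSpace ℝ (Fin n)) 1,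
      ∀ f : EuclideanSpace ℝ (Fin n) → ℝ, 0 < f a →
      (∀ x ∈ Metric.ball (0 : EuclideanSpace ℝ (Fin n)) 1,
        f x = f a * BallHarmonic.extremal a ξ x) →
      InnerProductSpace.HarmonicOnNhd f (Metric.ball 0 1) ∧
      ∀ x ∈ Metric.ball (0 : EuclideanSpace ℝ (Fin n)) 1,
        0 < f x ∧ ‖(‖x‖ ^ 2 - 1) • ∇ f x + (((n : ℝ) - 2) * f x) • x‖ = n * f x) := by
  have : NeZero n := ⟨by omega⟩
  refine ⟨fun f hf hpos => ⟨fun x hx => BallHarmonic.norm_gradient_le hf hpos hx,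
    fun a ha heq => BallHarmonic.eq_extremal_of_norm_gradient_eq hn hf hpos ha heq⟩,
    fun a ha ξ hξ f hfa hf => ?_⟩
  exact BallHarmonic.harmonic_and_norm_gradient_eq_of_eq_extremal hn ha (by simpa using hξ) hfa hf
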